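/- Let $\mathcal D$ (resp. $\mathcal D_{x,t}$) be the ring of germs at the origin of linear partial differential operators with analytic coefficients on $\mathbb C^n$ (resp. $\mathbb C^n\times\mathbb C$, coordinates $(x_1,\dots,x_n,t)$), with the order filtrations $F_d$. Let $V_k(\mathcal D_{x,t})$ be the set of operators all of whose monomials $x^\alpha t^\mu\partial_x^\beta\partial_t^\nu$ satisfy $\nu-\mu\le k$, and $F_{d,k}(\mathcal D_{x,t})=F_d(\mathcal D_{x,t})\cap V_k(\mathcal D_{x,t})$. A bifiltration of a left $\mathcal D_{x,t}$-module $M$ is an exhaustive family of subspaces $F_{d,k}(M)$ $(d,k\in\mathbb Z)$, increasing in $d$ and in $k$, with $F_{d,k}(\mathcal D_{x,t})F_{d',k'}(M)\subset F_{d+d',k+k'}(M)$; it is good if there are $f_1,\dots,f_r\in M$ and integers $n_i,m_i$ with $F_{d,k}(M)=\sum_i F_{d-n_i,k-m_i}(\mathcal D_{x,t})f_i$ for all $d,k$. Put $V_k(M)=\bigcup_dF_{d,k}(M)$. Let $\mathcal D_{x,t}^r[\mathbf n][\mathbf m]$ be the free module with $F_{d,k}=\bigoplus_iF_{d-n_i,k-m_i}(\mathcal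 D_{x,t})e_i$, and $\mathcal D^r[\mathbf n]$ the free $\mathcal D$-module with $F_d=\bigoplus_iF_{d-n_i}(\mathcal D)e_i$. Let $M$ be a left $\mathcal D_{x,t}$-module with a good bifiltration such that $M=\mathcal D_{x,t}V_0(M)$. Let $b\in\mathbb C[s]$ be a non-zero polynomial with $b(t\partial_t)V_0(M)\subset V_{-1}(M)$, and let $k_1$ be an integer with $b(k)\ne0$ for all integers $k>k_1$. If $k_1<-1$, assume moreover that $b(t\partial_t+k)V_k(M)\subset V_{k-1}(M)$ for $k_1<k<0$. Let $\cdots\to\mathcal L_1\to\mathcal L_0\to M\to0$ be a bifiltered free resolution, i.e. an exact sequence with each $\mathcal L_i$ of the form $\mathcal D_{x,t}^{r_i}[\mathbf n^{(i)}][\mathbf m^{(i)}]$ which induces for all $d,k$ an exact sequence $\cdots\to F_{d,k}(\mathcal L_1)\to F_{d,k}(\mathcal L_0)\to F_{d,k}(M)\to0$. Assume that $t:M\to M$ is injective and that $F_{d,k_1}(M)\cap tV_{k_1+1}(M)=tF_{d,k_1+1}(M)$ for all $d$. Filter $V_{k_1}(\mathcal L_i)/tV_{k_1+1}(\mathcal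 L_i)$ and $M/tM$ by the images of $F_{d,k_1}(\mathcal L_i)$ and $F_{d,k_1}(M)$ respectively. Then: 1. $F_{d,k_1}(\mathcal L_i)\cap tV_{k_1+1}(\mathcal L_i)=tF_{d,k_1+1}(\mathcal L_i)$ for all $i,d$. 2. The complex $$\cdots\to\frac{V_{k_1}(\mathcal L_1)}{tV_{k_1+1}(\mathcal L_1)}\to\frac{V_{k_1}(\mathcal L_0)}{tV_{k_1+1}(\mathcal L_0)}\to\frac M{tM}\to0$$ is an $F$-filtered free resolution of the $\mathcal D$-module $M/tM$: the filtration of $M/tM$ is exhaustive, each $V_{k_1}(\mathcal L_i)/tV_{k_1+1}(\mathcal L_i)$ is isomorphic as a filtered $\mathcal D$-module to some $\mathcal D^r[\mathbf n]$, the complex is exact, and for every $d$ the induced complex $$\cdots\to\frac{F_{d,k_1}(\mathcal L_1)}{tF_{d,k_1+1}(\mathcal L_1)}\to\frac{F_{d,k_1}(\mathcal L_0)}{tF_{d,k_1+1}(\mathcal L_0)}\to F_d\Big(\frac M{tM}\Big)\to0$$ is exact. 3. Write $\mathbf R\mathcal D=\bigoplus_dF_d(\mathcal D)T^d$, $\mathbf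 RN=\bigoplus_dF_d(N)T^d$ for a filtered $\mathcal D$-module $N$, and $V_k(\mathbf R\mathcal L_i)=\bigoplus_dF_{d,k}(\mathcal L_i)T^d$. The isomorphisms of $\mathbf R\mathcal D$-modules $\mathbf R\big(V_{k_1}(\mathcal L_i)/tV_{k_1+1}(\mathcal L_i)\big)\simeq V_{k_1}(\mathbf R\mathcal L_i)/tV_{k_1+1}(\mathbf R\mathcal L_i)$, $[x]T^d\mapsto[xT^d]$, exist and identify the homogenization of the resolution in 2 with $$\cdots\to\frac{V_{k_1}(\mathbf R\mathcal L_1)}{tV_{k_1+1}(\mathbf R\mathcal L_1)}\to\frac{V_{k_1}(\mathbf R\mathcal L_0)}{tV_{k_1+1}(\mathbf R\mathcal L_0)}\to\mathbf R\Big(\frac M{tM}\Big)\to0,$$ which is a graded free resolution of $\mathbf R(M/tM)$ over $\mathbf R\mathcal D$. -/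

import Mathlib

open scoped NNReal DirectSum

noncomputable section

namespace FilteredRestriction

/-! ### Convergent power series -/

/-- A power series `∑ c_α z^α` over `ℂ` in finitely many variables is convergent (near the origin)
iff `|c_α| ≤ C r^|α|` for some constants `C`, `r`. -/
def IsConvergent {σ : Type*} (f : MvPowerSeries σ ℂ) : Prop :=
  ∃ C r : ℝ≥0, ∀ α : σ →₀ ℕ, ‖MvPowerSeries.coeff α f‖₊ ≤ C * r ^ α.degree

lemma card_antidiagonal_le {σ : Type*} [DecidableEq σ] (α : σ →₀ ℕ) :
    (Finset.HasAntidiagonal.antidiagonal α).card ≤ 2 ^ α.degree := by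
  have h1 : (Finset.HasAntidiagonal.antidiagonal α).card ≤ (Finset.Iic α).card := by
    refine Finset.card_le_card_of_injOn Prod.fst ?_ ?_
    · intro p hp
      rw [Finset.mem_coe, Finset.HasAntidiagonal.mem_antidiagonal] at hp
      simp only [Finset.coe_Iic, Set.mem_Iic]
      rw [← hp]
      exact le_self_add
    · rintro ⟨a, b⟩ hp ⟨a', b'⟩ hp' h
      simp only [Finset.mem_coe, Finset.HasAntidiagonal.mem_antidiagonal] at hp hp' h
      subst h
      rw [← hp'] at hp
      simpa using hp
  refine h1.trans ?_
  rw [Finsupp.card_Iic, Finsupp.degree_apply, ← Finset.prod_pow_eq_pow_sum]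
  refine Finset.prod_le_prod' fun i _ => ?_
  rw [Nat.card_Iic]
  exact Nat.lt_two_pow_self

lemma IsConvergent.mul {σ : Type*} {f g : MvPowerSeries σ ℂ} (hf : IsConvergent f)
    (hg : IsConvergent g) : IsConvergent (f * g) := by
  classical
  obtain ⟨C, r, hf⟩ := hf
  obtain ⟨C', r', hg⟩ := hg
  refine ⟨C * C', 2 * max r r', fun α => ?_⟩
  rw [MvPowerSeries.coeff_mul]
  have : ∀ p ∈ Finset.HasAntidiagonal.antidiagonal α,
      ‖MvPowerSeries.coeff p.1 f * MvPowerSeries.coeff p.2 g‖₊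
        ≤ C * C' * (max r r') ^ α.degree := by
    intro p hp
    rw [Finset.HasAntidiagonal.mem_antidiagonal] at hp
    rw [nnnorm_mul, ← hp, map_add, pow_add]
    calc _ ≤ (C * r ^ p.1.degree) * (C' * r' ^ p.2.degree) := mul_le_mul' (hf _) (hg _)
      _ ≤ (C * max r r' ^ p.1.degree) * (C' * max r r' ^ p.2.degree) := by
        gcongr
        · exact le_max_left _ _
        · exact le_max_right _ _
      _ = _ := by ring
  refine (nnnorm_sum_le _ _).trans ((Finset.sum_le_card_nsmul _ _ _ this).trans ?_)
  rw [nsmul_eq_mul]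
  calc _ ≤ ((2 : ℝ≥0) ^ α.degree) * (C * C' * (max r r') ^ α.degree) := by
        gcongr
        exact_mod_cast card_antidiagonal_le α
    _ = _ := by rw [mul_pow]; ring

lemma IsConvergent.add {σ : Type*} {f g : MvPowerSeries σ ℂ} (hf : IsConvergent f)
    (hg : IsConvergent g) : IsConvergent (f + g) := by
  obtain ⟨C, r, hf⟩ := hf
  obtain ⟨C', r', hg⟩ := hg
  refine ⟨C + C', max r r', fun α => ?_⟩
  rw [map_add, add_mul]
  refine (nnnorm_add_le _ _).trans (add_le_add ((hf α).trans ?_) ((hg α).trans ?_))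
  · gcongr
    exact le_max_left _ _
  · gcongr
    exact le_max_right _ _

lemma isConvergent_C {σ : Type*} (c : ℂ) : IsConvergent (MvPowerSeries.C (σ := σ) c) := by
  classical
  refine ⟨‖c‖₊, 1, fun α => ?_⟩
  rw [MvPowerSeries.coeff_C]
  split_ifs <;> simp

lemma isConvergent_X {σ : Type*} (i : σ) : IsConvergent (MvPowerSeries.X i : MvPowerSeries σ ℂ) := by
  classical
  refine ⟨1, 1, fun α => ?_⟩
  rw [MvPowerSeries.coeff_X]
  split_ifs <;> simp

lemma IsConvergent.pderiv {σ : Type*} {f : MvPowerSeries σ ℂ} (hf : IsConvergent f) (i : σ) :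
    IsConvergent (MvPowerSeries.pderiv ℂ i f) := by
  obtain ⟨C, r, hf⟩ := hf
  refine ⟨C * r, 2 * r, fun α => ?_⟩
  rw [MvPowerSeries.coeff_pderiv, nnnorm_mul]
  have h1 : ‖((α i : ℂ) + 1)‖₊ ≤ 2 ^ α.degree := by
    have : α i + 1 ≤ 2 ^ α.degree :=
      (Nat.lt_two_pow_self (n := α i)).trans_le
        (Nat.pow_le_pow_right (by norm_num) (Finsupp.le_degree i α))
    have h2 : ‖((α i : ℂ) + 1)‖₊ = ((α i + 1 : ℕ) : ℝ≥0) := by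
      rw [← Nat.cast_succ, Nat.succ_eq_add_one]
      exact Complex.nnnorm_natCast (α i + 1)
    rw [h2]
    exact_mod_cast this
  calc _ ≤ (C * r ^ (α + Finsupp.single i 1).degree) * 2 ^ α.degree := mul_le_mul' (hf _) h1
    _ = _ := by
      rw [map_add, Finsupp.degree_single, pow_succ, mul_pow]
      ring

/-- The algebra of convergent power series in the variables `x_1, …, x_n, t`. The variables are
indexed by `Fin (n + 1)`; `t` is the last one. -/
def OAlg (n : ℕ) : Subalgebra ℂ (MvPowerSeries (Fin (n + 1)) ℂ) where
  carrier := {f | IsConvergent f}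
  mul_mem' := IsConvergent.mul
  add_mem' := IsConvergent.add
  algebraMap_mem' c := isConvergent_C c

/-- The ring `ℂ{x_1, …, x_n, t}` of convergent power series. -/
def O (n : ℕ) : Type := ↥(OAlg n)

instance (n : ℕ) : CommRing (O n) := inferInstanceAs (CommRing ↥(OAlg n))

instance (n : ℕ) : Algebra ℂ (O n) := inferInstanceAs (Algebra ℂ ↥(OAlg n))

/-- The power series underlying an element of `ℂ{x, t}`. -/
def ser {n : ℕ} : O n →ₐ[ℂ] MvPowerSeries (Fin (n + 1)) ℂ := (OAlg n).val

/-! ### The ring of differential operators and its filtrations -/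

/-- The partial derivative `∂_i` as a `ℂ`-linear endomorphism of `ℂ{x, t}`. -/
def pd (n : ℕ) (i : Fin (n + 1)) : Module.End ℂ (O n) where
  toFun f := ⟨MvPowerSeries.pderiv ℂ i (ser f), IsConvergent.pderiv f.2 i⟩
  map_add' f g := Subtype.ext (by
    change MvPowerSeries.pderiv ℂ i (ser (f + g)) = _
    rw [map_add, map_add]
    rfl)
  map_smul' c f := Subtype.ext (by
    change MvPowerSeries.pderiv ℂ i (ser (c • f)) = _
    rw [map_smul, Derivation.map_smul]
    rfl)

/-- The algebra of endomorphisms of `ℂ{x, t}` generated by the multiplications by elements of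
`ℂ{x, t}` and by the partial derivatives. -/
def DxtAlg (n : ℕ) : Subalgebra ℂ (Module.End ℂ (O n)) :=
  Algebra.adjoin ℂ (Set.range (Algebra.lmul ℂ (O n)) ∪ Set.range (pd n))

/-- The ring `𝒟_{x,t}` of germs at the origin of linear partial differential operators with
analytic coefficients, acting on `ℂ{x, t}`. -/
def Dxt (n : ℕ) : Type := ↥(DxtAlg n)

instance (n : ℕ) : Ring (Dxt n) := inferInstanceAs (Ring ↥(DxtAlg n))

instance (n : ℕ) : Algebra ℂ (Dxt n) := inferInstanceAs (Algebra ℂ ↥(DxtAlg n))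

/-- The action of `𝒟_{x,t}` on `ℂ{x, t}`. -/
def act (n : ℕ) : Dxt n →ₐ[ℂ] Module.End ℂ (O n) := (DxtAlg n).val

lemma act_injective (n : ℕ) : Function.Injective (act n) := Subtype.val_injective

/-- A convergent power series as a differential operator of order `0`. -/
def germ {n : ℕ} (a : O n) : Dxt n :=
  ⟨Algebra.lmul ℂ (O n) a, Algebra.subset_adjoin (Or.inl ⟨a, rfl⟩)⟩

/-- The derivation `∂_i` as an element of `𝒟_{x,t}`. -/
def del {n : ℕ} (i : Fin (n + 1)) : Dxt n :=
  ⟨pd n i, Algebra.subset_adjoin (Or.inr ⟨i, rfl⟩)⟩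

/-- The variable `t` as a convergent power series. -/
def tO (n : ℕ) : O n := ⟨MvPowerSeries.X (Fin.last n), isConvergent_X _⟩

lemma ser_tO (n : ℕ) : ser (tO n) = MvPowerSeries.X (Fin.last n) := rfl

/-- The variable `t` as a differential operator. -/
def t (n : ℕ) : Dxt n := germ (tO n)

/-- The derivation `∂_t`. -/
def dt (n : ℕ) : Dxt n := del (Fin.last n)

/-- The operator `a ∂_{i_1} ⋯ ∂_{i_l}`, for `a ∈ ℂ{x, t}` and `w = [i_1, …, i_l]`.
(The derivations commute, so this is `a ∂^β` where `β_i` is the number of occurrences of `i`.) -/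
def mono {n : ℕ} (a : O n) (w : List (Fin (n + 1))) : Dxt n := germ a * (w.map del).prod

/-- The filtration of `𝒟_{x,t}` by the order: `F_d` consists of the sums of operators `a ∂^β`
with `|β| ≤ d`. -/
def FD (n : ℕ) (d : ℤ) : Submodule ℂ (Dxt n) :=
  Submodule.span ℂ {P | ∃ (a : O n) (w : List (Fin (n + 1))),
    (w.length : ℤ) ≤ d ∧ P = mono a w}

/-- The `V`-filtration of `𝒟_{x,t}`: `V_k` consists of the operators all of whose monomials
`x^α t^μ ∂_x^β ∂_t^ν` satisfy `ν - μ ≤ k`. -/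
def VD (n : ℕ) (k : ℤ) : Submodule ℂ (Dxt n) :=
  Submodule.span ℂ {P | ∃ (a : O n) (w : List (Fin (n + 1))),
    (∀ α : Fin (n + 1) →₀ ℕ, MvPowerSeries.coeff α (ser a) ≠ 0 →
      (w.count (Fin.last n) : ℤ) - α (Fin.last n) ≤ k) ∧ P = mono a w}

/-- The bifiltration `F_{d,k}(𝒟_{x,t}) = F_d(𝒟_{x,t}) ∩ V_k(𝒟_{x,t})`. -/
def FVD (n : ℕ) (d k : ℤ) : Submodule ℂ (Dxt n) := FD n d ⊓ VD n k

/-- The ring `𝒟` of germs at the origin of linear partial differential operators in the variables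
`x_1, …, x_n` only, realised inside `𝒟_{x,t}` as the subalgebra of the operators in which neither
`t` nor `∂_t` occurs: it is generated by `ℂ{x}` and `∂_{x_1}, …, ∂_{x_n}`. -/
def DxAlg (n : ℕ) : Subalgebra ℂ (Dxt n) :=
  Algebra.adjoin ℂ
    ({P | ∃ a : O n, (∀ α : Fin (n + 1) →₀ ℕ,
        MvPowerSeries.coeff α (ser a) ≠ 0 → α (Fin.last n) = 0) ∧
        P = germ a} ∪
      Set.range fun i : Fin n => del i.castSucc)

/-- The ring `𝒟` as a type. -/
def Dx (n : ℕ) : Type := ↥(DxAlg n)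

instance (n : ℕ) : Ring (Dx n) := inferInstanceAs (Ring ↥(DxAlg n))

instance (n : ℕ) : Algebra ℂ (Dx n) := inferInstanceAs (Algebra ℂ ↥(DxAlg n))

/-- The inclusion `𝒟 ⊂ 𝒟_{x,t}`. -/
def incl (n : ℕ) : Dx n →ₐ[ℂ] Dxt n := (DxAlg n).val

lemma incl_mem {n : ℕ} (P : Dx n) : incl n P ∈ DxAlg n := P.2

/-- Every `𝒟_{x,t}`-module is a `𝒟`-module by restriction of scalars. -/
instance instModuleDx (n : ℕ) (M : Type*) [AddCommGroup M] [Module (Dxt n) M] : Module (Dx n) M :=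
  Module.compHom M (incl n).toRingHom

lemma Dx_smul_def {n : ℕ} {M : Type*} [AddCommGroup M] [Module (Dxt n) M] (P : Dx n) (x : M) :
    P • x = incl n P • x := rfl

instance {n : ℕ} {M M' : Type*} [AddCommGroup M] [Module (Dxt n) M] [AddCommGroup M']
    [Module (Dxt n) M'] : LinearMap.CompatibleSMul M M' (Dx n) (Dxt n) where
  map_smul f P x := f.map_smul (incl n P) x

/-- The filtration of `𝒟` by the order. -/
def FDx (n : ℕ) (d : ℤ) : Submodule ℂ (Dx n) := (FD n d).comap (incl n).toLinearMap

/-! ### Multiplicativity of the filtrations -/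

lemma germ_mul {n : ℕ} (a b : O n) : germ (a * b) = germ a * germ b :=
  act_injective n (map_mul (Algebra.lmul ℂ (O n)) a b)

lemma germ_one {n : ℕ} : germ (1 : O n) = 1 := act_injective n (map_one (Algebra.lmul ℂ (O n)))

/-- The partial derivative of a convergent power series. -/
def pdv {n : ℕ} (i : Fin (n + 1)) (a : O n) : O n := pd n i a

lemma coe_pdv {n : ℕ} (i : Fin (n + 1)) (a : O n) :
    ser (pdv i a) = MvPowerSeries.pderiv ℂ i (ser a) := rfl

lemma del_mul_germ {n : ℕ} (i : Fin (n + 1)) (a : O n) :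
    del i * germ a = germ (pdv i a) + germ a * del i := by
  apply act_injective n
  ext f : 1
  apply Subtype.ext
  change MvPowerSeries.pderiv ℂ i (ser (a * f)) =
    MvPowerSeries.pderiv ℂ i (ser a) * ser f + ser a * MvPowerSeries.pderiv ℂ i (ser f)
  rw [map_mul, Derivation.leibniz, smul_eq_mul, smul_eq_mul]
  ring

lemma germ_mul_mono {n : ℕ} (a b : O n) (w : List (Fin (n + 1))) :
    germ a * mono b w = mono (a * b) w := by
  rw [mono, mono, germ_mul, mul_assoc]

lemma del_mul_mono {n : ℕ} (i : Fin (n + 1)) (b : O n) (w : List (Fin (n + 1))) :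
    del i * mono b w = mono (pdv i b) w + mono b (i :: w) := by
  simp only [mono, List.map_cons, List.prod_cons]
  rw [← mul_assoc, del_mul_germ, add_mul, mul_assoc (germ b)]

lemma germ_mul_mem_FD {n : ℕ} {d : ℤ} (a : O n) {Q : Dxt n} (hQ : Q ∈ FD n d) :
    germ a * Q ∈ FD n d := by
  induction hQ using Submodule.span_induction with
  | mem Q h =>
    obtain ⟨b, w, hw, rfl⟩ := h
    rw [germ_mul_mono]
    exact Submodule.subset_span ⟨_, w, hw, rfl⟩
  | zero => simp
  | add x y _ _ hx hy => rw [mul_add]; exact add_mem hx hy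
  | smul c x _ hx => rw [mul_smul_comm]; exact Submodule.smul_mem _ _ hx

lemma FD_mono {n : ℕ} {d e : ℤ} (h : d ≤ e) : FD n d ≤ FD n e :=
  Submodule.span_mono fun _ ⟨a, w, hw, hP⟩ => ⟨a, w, hw.trans h, hP⟩

lemma VD_mono {n : ℕ} {d e : ℤ} (h : d ≤ e) : VD n d ≤ VD n e :=
  Submodule.span_mono fun _ ⟨a, w, hw, hP⟩ => ⟨a, w, fun α hα => (hw α hα).trans h, hP⟩

lemma del_mul_mem_FD {n : ℕ} {d : ℤ} (i : Fin (n + 1)) {Q : Dxt n} (hQ : Q ∈ FD n d) :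
    del i * Q ∈ FD n (d + 1) := by
  induction hQ using Submodule.span_induction with
  | mem Q h =>
    obtain ⟨b, w, hw, rfl⟩ := h
    rw [del_mul_mono]
    refine add_mem (Submodule.subset_span ⟨_, w, by linarith, rfl⟩)
      (Submodule.subset_span ⟨_, _, ?_, rfl⟩)
    rw [List.length_cons]
    push_cast
    linarith
  | zero => simp
  | add x y _ _ hx hy => rw [mul_add]; exact add_mem hx hy
  | smul c x _ hx => rw [mul_smul_comm]; exact Submodule.smul_mem _ _ hx

lemma mul_mem_FD {n : ℕ} {d e : ℤ} {P Q : Dxt n} (hP : P ∈ FD n d) (hQ : Q ∈ FD n e) :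
    P * Q ∈ FD n (d + e) := by
  induction hP using Submodule.span_induction with
  | mem P h =>
    obtain ⟨a, w, hw, rfl⟩ := h
    rw [mono, mul_assoc]
    apply germ_mul_mem_FD
    suffices h : (w.map del).prod * Q ∈ FD n (w.length + e) from FD_mono (by linarith) h
    clear hw
    induction w with
    | nil => simpa using hQ
    | cons i w ih =>
      rw [List.map_cons, List.prod_cons, mul_assoc, List.length_cons]
      push_cast
      rw [add_right_comm]
      exact del_mul_mem_FD i ih
  | zero => simp
  | add x y _ _ hx hy => rw [add_mul]; exact add_mem hx hy
  | smul c x _ hx => rw [smul_mul_assoc]; exact Submodule.smul_mem _ _ hx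

lemma germ_mul_mem_VD {n : ℕ} {k s : ℤ} (a : O n)
    (ha : ∀ α : Fin (n + 1) →₀ ℕ, MvPowerSeries.coeff α (ser a) ≠ 0 →
      -(α (Fin.last n) : ℤ) ≤ s) {Q : Dxt n} (hQ : Q ∈ VD n k) :
    germ a * Q ∈ VD n (s + k) := by
  classical
  induction hQ using Submodule.span_induction with
  | mem Q h =>
    obtain ⟨b, w, hw, rfl⟩ := h
    rw [germ_mul_mono]
    refine Submodule.subset_span ⟨_, w, fun α hα => ?_, rfl⟩
    rw [map_mul, MvPowerSeries.coeff_mul] at hα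
    obtain ⟨p, hp, hne⟩ := Finset.exists_ne_zero_of_sum_ne_zero hα
    rw [Finset.HasAntidiagonal.mem_antidiagonal] at hp
    have h1 := ha p.1 (left_ne_zero_of_mul hne)
    have h2 := hw p.2 (right_ne_zero_of_mul hne)
    rw [← hp, Finsupp.add_apply]
    push_cast
    linarith
  | zero => simp
  | add x y _ _ hx hy => rw [mul_add]; exact add_mem hx hy
  | smul c x _ hx => rw [mul_smul_comm]; exact Submodule.smul_mem _ _ hx

lemma del_mul_mem_VD {n : ℕ} {k : ℤ} (i : Fin (n + 1)) {Q : Dxt n} (hQ : Q ∈ VD n k) :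
    del i * Q ∈ VD n (k + if i = Fin.last n then 1 else 0) := by
  classical
  induction hQ using Submodule.span_induction with
  | mem Q h =>
    obtain ⟨b, w, hw, rfl⟩ := h
    rw [del_mul_mono]
    refine add_mem (Submodule.subset_span ⟨_, w, fun α hα => ?_, rfl⟩)
      (Submodule.subset_span ⟨_, _, fun α hα => ?_, rfl⟩)
    · rw [coe_pdv, MvPowerSeries.coeff_pderiv] at hα
      have := hw _ (left_ne_zero_of_mul hα)
      rw [Finsupp.add_apply, Finsupp.single_apply] at this
      split_ifs at this ⊢ <;> push_cast at this <;> linarith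
    · have := hw α hα
      rw [List.count_cons]
      by_cases h : i = Fin.last n
      · simp only [h, beq_self_eq_true, if_true]
        push_cast
        linarith
      · simp only [h, beq_iff_eq, if_false]
        push_cast
        linarith
  | zero => simp
  | add x y _ _ hx hy => rw [mul_add]; exact add_mem hx hy
  | smul c x _ hx => rw [mul_smul_comm]; exact Submodule.smul_mem _ _ hx

lemma mul_mem_VD {n : ℕ} {k l : ℤ} {P Q : Dxt n} (hP : P ∈ VD n k) (hQ : Q ∈ VD n l) :
    P * Q ∈ VD n (k + l) := by
  classical
  induction hP using Submodule.span_induction with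
  | mem P h =>
    obtain ⟨a, w, hw, rfl⟩ := h
    rw [mono, mul_assoc]
    have h : (w.map del).prod * Q ∈ VD n (w.count (Fin.last n) + l) := by
      clear hw
      induction w with
      | nil => simpa using hQ
      | cons i w ih =>
        rw [List.map_cons, List.prod_cons, mul_assoc, List.count_cons]
        refine VD_mono (le_of_eq ?_) (del_mul_mem_VD i ih)
        by_cases h : i = Fin.last n
        · simp only [h, beq_self_eq_true, if_true]
          push_cast
          ring
        · simp only [h, beq_iff_eq, if_false]
          push_cast
          ring
    have h2 := germ_mul_mem_VD (s := k - w.count (Fin.last n)) a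
      (fun α hα => by have := hw α hα; linarith) h
    exact VD_mono (by linarith) h2
  | zero => simp
  | add x y _ _ hx hy => rw [add_mul]; exact add_mem hx hy
  | smul c x _ hx => rw [smul_mul_assoc]; exact Submodule.smul_mem _ _ hx

lemma mul_mem_FVD {n : ℕ} {d e k l : ℤ} {P Q : Dxt n} (hP : P ∈ FVD n d k) (hQ : Q ∈ FVD n e l) :
    P * Q ∈ FVD n (d + e) (k + l) :=
  ⟨mul_mem_FD hP.1 hQ.1, mul_mem_VD hP.2 hQ.2⟩

lemma germ_mem_FD {n : ℕ} (a : O n) : germ a ∈ FD n 0 :=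
  Submodule.subset_span ⟨a, [], by simp, by simp [mono]⟩

lemma germ_mem_VD {n : ℕ} {k : ℤ} (a : O n)
    (ha : ∀ α : Fin (n + 1) →₀ ℕ, MvPowerSeries.coeff α (ser a) ≠ 0 →
      -(α (Fin.last n) : ℤ) ≤ k) : germ a ∈ VD n k :=
  Submodule.subset_span ⟨a, [], by simpa using ha, by simp [mono]⟩

lemma one_mem_FD (n : ℕ) : (1 : Dxt n) ∈ FD n 0 := germ_one (n := n) ▸ germ_mem_FD 1

lemma one_mem_VD (n : ℕ) : (1 : Dxt n) ∈ VD n 0 :=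
  germ_one (n := n) ▸ germ_mem_VD 1 fun α _ => by simp

lemma del_mem_FD {n : ℕ} (i : Fin (n + 1)) : del i ∈ FD n 1 :=
  Submodule.subset_span ⟨1, [i], by simp, by simp [mono, germ_one]⟩

lemma del_mem_VD {n : ℕ} (i : Fin (n + 1)) : del i ∈ VD n (if i = Fin.last n then 1 else 0) := by
  simpa using del_mul_mem_VD i (one_mem_VD n)

lemma t_mem_FVD (n : ℕ) : t n ∈ FVD n 0 (-1) := by
  classical
  refine ⟨germ_mem_FD _, germ_mem_VD _ fun α hα => ?_⟩
  rw [ser_tO, MvPowerSeries.coeff_X] at hα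
  have h : α = Finsupp.single (Fin.last n) 1 := by
    by_contra h
    exact hα (if_neg h)
  rw [h]
  simp

lemma Dx_le_VD {n : ℕ} {P : Dxt n} (hP : P ∈ DxAlg n) : P ∈ VD n 0 := by
  induction hP using Algebra.adjoin_induction with
  | mem P h =>
    rcases h with ⟨a, -, rfl⟩ | ⟨i, rfl⟩
    · exact germ_mem_VD a fun α _ => by simp
    · simpa [(Fin.castSucc_lt_last i).ne] using del_mem_VD i.castSucc
  | algebraMap c =>
    rw [Algebra.algebraMap_eq_smul_one]
    exact Submodule.smul_mem _ _ (one_mem_VD n)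
  | add x y _ _ hx hy => exact add_mem hx hy
  | mul x y _ _ hx hy => simpa using mul_mem_VD hx hy

lemma Dx_exists_FD {n : ℕ} {P : Dxt n} (hP : P ∈ DxAlg n) : ∃ d, P ∈ FD n d := by
  induction hP using Algebra.adjoin_induction with
  | mem P h =>
    rcases h with ⟨a, -, rfl⟩ | ⟨i, rfl⟩
    · exact ⟨0, germ_mem_FD a⟩
    · exact ⟨1, del_mem_FD _⟩
  | algebraMap c =>
    rw [Algebra.algebraMap_eq_smul_one]
    exact ⟨0, Submodule.smul_mem _ _ (one_mem_FD n)⟩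
  | add x y _ _ hx hy =>
    obtain ⟨d, hx⟩ := hx
    obtain ⟨e, hy⟩ := hy
    exact ⟨max d e, add_mem (FD_mono (le_max_left _ _) hx) (FD_mono (le_max_right _ _) hy)⟩
  | mul x y _ _ hx hy =>
    obtain ⟨d, hx⟩ := hx
    obtain ⟨e, hy⟩ := hy
    exact ⟨d + e, mul_mem_FD hx hy⟩

lemma exists_FVD {n : ℕ} (P : Dxt n) : ∃ d k, P ∈ FVD n d k := by
  have key : ∀ P Q : Dxt n, (∃ d k, P ∈ FVD n d k) → (∃ d k, Q ∈ FVD n d k) →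
      (∃ d k, P + Q ∈ FVD n d k) ∧ ∃ d k, P * Q ∈ FVD n d k := by
    rintro P Q ⟨d, k, hP⟩ ⟨e, l, hQ⟩
    exact ⟨⟨max d e, max k l,
      add_mem (FD_mono (le_max_left _ _) hP.1) (FD_mono (le_max_right _ _) hQ.1),
      add_mem (VD_mono (le_max_left _ _) hP.2) (VD_mono (le_max_right _ _) hQ.2)⟩,
      _, _, mul_mem_FVD hP hQ⟩
  obtain ⟨P, hP⟩ := P
  have : ∃ h : P ∈ DxtAlg n, ∃ d k, (⟨P, h⟩ : Dxt n) ∈ FVD n d k := by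
    induction hP using Algebra.adjoin_induction with
    | mem P h =>
      rcases h with ⟨a, rfl⟩ | ⟨i, rfl⟩
      · exact ⟨_, 0, 0, germ_mem_FD a, germ_mem_VD a fun α _ => by simp⟩
      · exact ⟨_, 1, _, del_mem_FD i, del_mem_VD i⟩
    | algebraMap c =>
      refine ⟨Subalgebra.algebraMap_mem _ c, 0, 0, ?_⟩
      have h : (algebraMap ℂ (Dxt n) c) ∈ FVD n 0 0 := by
        rw [Algebra.algebraMap_eq_smul_one]
        exact Submodule.smul_mem _ _ ⟨one_mem_FD n, one_mem_VD n⟩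
      exact h
    | add x y _ _ h1 h2 =>
      obtain ⟨hx, h1⟩ := h1
      obtain ⟨hy, h2⟩ := h2
      exact ⟨add_mem hx hy, (key ⟨x, hx⟩ ⟨y, hy⟩ h1 h2).1⟩
    | mul x y _ _ h1 h2 =>
      obtain ⟨hx, h1⟩ := h1
      obtain ⟨hy, h2⟩ := h2
      exact ⟨mul_mem hx hy, (key ⟨x, hx⟩ ⟨y, hy⟩ h1 h2).2⟩
  exact this.2

lemma t_comm {n : ℕ} {P : Dxt n} (hP : P ∈ DxAlg n) : t n * P = P * t n := by
  have : DxAlg n ≤ Subalgebra.centralizer ℂ {t n} := by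
    refine Algebra.adjoin_le ?_
    rintro P (⟨a, -, rfl⟩ | ⟨i, rfl⟩)
    · refine (Subalgebra.mem_centralizer_iff ℂ).2 fun g hg => ?_
      rw [Set.mem_singleton_iff.1 hg, t, ← germ_mul, ← germ_mul, mul_comm]
    · refine (Subalgebra.mem_centralizer_iff ℂ).2 fun g hg => ?_
      dsimp only
      rw [Set.mem_singleton_iff.1 hg, t, del_mul_germ]
      have h0 : pdv i.castSucc (tO n) = 0 := by
        classical
        apply Subtype.ext
        change ser (pdv i.castSucc (tO n)) = 0
        rw [coe_pdv, ser_tO]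
        ext α
        rw [MvPowerSeries.coeff_pderiv, MvPowerSeries.coeff_X, if_neg, zero_mul, map_zero]
        intro h
        have h' := DFunLike.congr_fun h i.castSucc
        simp at h'
      have hz : germ (0 : O n) = 0 := act_injective n (map_zero (Algebra.lmul ℂ (O n)))
      rw [h0, hz, zero_add]
  exact (Subalgebra.mem_centralizer_iff ℂ).1 (this hP) (t n) rfl

/-! ### Bifiltered `𝒟_{x,t}`-modules -/

/-- A bifiltration of a left `𝒟_{x,t}`-module. (Each `F_{d,k}` is a `ℂ`-subspace, because
`ℂ ⊂ F_{0,0}(𝒟_{x,t})`.) -/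
structure Bifiltration (n : ℕ) (M : Type*) [AddCommGroup M] [Module (Dxt n) M] where
  F : ℤ → ℤ → AddSubgroup M
  mono_left : ∀ d k, F d k ≤ F (d + 1) k
  mono_right : ∀ d k, F d k ≤ F d (k + 1)
  smul_mem : ∀ {d k d' k' : ℤ} {P : Dxt n} {x : M},
    P ∈ FVD n d k → x ∈ F d' k' → P • x ∈ F (d + d') (k + k')
  exhaustive : ∀ x : M, ∃ d k, x ∈ F d k

/-- A (pre-)filtration of a left `𝒟`-module, compatible with the order filtration of `𝒟`. -/
structure FFiltration (n : ℕ) (N : Type*) [AddCommGroup N] [Module (Dx n) N] where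
  F : ℤ → AddSubgroup N
  mono : ∀ d, F d ≤ F (d + 1)
  smul_mem : ∀ {d d' : ℤ} {P : Dx n} {x : N}, P ∈ FDx n d → x ∈ F d' → P • x ∈ F (d + d')

/-- A linear map of filtered `𝒟`-modules is filtered if it maps `F_d` to `F_d`. -/
def IsFiltered {n : ℕ} {N N' : Type*} [AddCommGroup N] [Module (Dx n) N] [AddCommGroup N']
    [Module (Dx n) N'] (Φ : FFiltration n N) (Φ' : FFiltration n N') (φ : N →ₗ[Dx n] N') : Prop :=
  ∀ d, ∀ x ∈ Φ.F d, φ x ∈ Φ'.F d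

/-- The filtration is exhaustive. -/
def FFiltration.IsExhaustive {n : ℕ} {N : Type*} [AddCommGroup N] [Module (Dx n) N]
    (Φ : FFiltration n N) : Prop := ∀ x : N, ∃ d, x ∈ Φ.F d

/-- Multiplication by `t` on a `𝒟_{x,t}`-module; it is `𝒟`-linear. -/
def tmul (n : ℕ) (M : Type*) [AddCommGroup M] [Module (Dxt n) M] : M →ₗ[Dx n] M where
  toFun x := t n • x
  map_add' := smul_add _
  map_smul' P x := by
    change t n • (incl n P • x) = incl n P • (t n • x)
    rw [← mul_smul, ← mul_smul, t_comm (incl_mem P)]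

namespace Bifiltration

variable {n : ℕ} {M : Type*} [AddCommGroup M] [Module (Dxt n) M] (B : Bifiltration n M)

/-- The bifiltration is good: there are `f_1, …, f_r ∈ M` and shifts `n_i`, `m_i` with
`F_{d,k}(M) = ∑ F_{d - n_i, k - m_i}(𝒟_{x,t}) f_i` for all `d`, `k`. -/
def IsGood : Prop :=
  ∃ (r : ℕ) (f : Fin r → M) (sF sV : Fin r → ℤ), ∀ (d k : ℤ) (x : M), x ∈ B.F d k ↔
    ∃ P : Fin r → Dxt n, (∀ i, P i ∈ FVD n (d - sF i) (k - sV i)) ∧ x = ∑ i, P i • f i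

lemma monotone_left (k : ℤ) : Monotone fun d => B.F d k :=
  monotone_int_of_le_succ fun d => B.mono_left d k

lemma Dx_smul_mem {d d' k : ℤ} {P : Dx n} {x : M} (hP : P ∈ FDx n d) (hx : x ∈ B.F d' k) :
    P • x ∈ B.F (d + d') k := by
  have h := B.smul_mem (d := d) (k := 0) ⟨hP, Dx_le_VD P.2⟩ hx
  rwa [zero_add] at h

/-- `V_k(M) = ⋃_d F_{d,k}(M)`, a `𝒟`-submodule of `M`. -/
def V (k : ℤ) : Submodule (Dx n) M where
  carrier := {x | ∃ d, x ∈ B.F d k}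
  add_mem' := by
    rintro x y ⟨d, hx⟩ ⟨e, hy⟩
    exact ⟨max d e, add_mem (B.monotone_left k (le_max_left _ _) hx)
      (B.monotone_left k (le_max_right _ _) hy)⟩
  zero_mem' := ⟨0, zero_mem _⟩
  smul_mem' P x := by
    rintro ⟨d, hx⟩
    obtain ⟨e, he⟩ := Dx_exists_FD P.2
    exact ⟨e + d, B.Dx_smul_mem he hx⟩

/-- `t V_{k+1}(M)` as a `𝒟`-submodule of `M`. -/
def tV (k : ℤ) : Submodule (Dx n) M := (B.V (k + 1)).map (tmul n M)

lemma t_smul_mem {d k : ℤ} {x : M} (hx : x ∈ B.F d (k + 1)) : tmul n M x ∈ B.F d k := by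
  have h := B.smul_mem (t_mem_FVD n) hx
  rwa [zero_add, neg_add_cancel_comm_assoc] at h

/-- The `𝒟`-module `V_k(M) / t V_{k+1}(M)`. -/
abbrev VQ (k : ℤ) : Type _ := (B.V k) ⧸ (B.tV k).submoduleOf (B.V k)

/-- The family `(F_{d,k}(M))_d` for fixed `k`, as a filtration (of `V_k(M) ⊂ M`). -/
def level (k : ℤ) : FFiltration n M where
  F d := B.F d k
  mono d := B.mono_left d k
  smul_mem := B.Dx_smul_mem

/-- The filtration of `V_k(M) / t V_{k+1}(M)` by
`F_{d,k}(M) / (F_{d,k}(M) ∩ t V_{k+1}(M))`, i.e. by the images of the `F_{d,k}(M)`. -/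
def filVQ (k : ℤ) : FFiltration n (B.VQ k) where
  F d := ((B.F d k).comap (B.V k).subtype.toAddMonoidHom).map
    ((B.tV k).submoduleOf (B.V k)).mkQ.toAddMonoidHom
  mono d := AddSubgroup.map_mono (AddSubgroup.comap_mono (B.mono_left d k))
  smul_mem := by
    rintro d d' P _ hP ⟨x, hx, rfl⟩
    exact ⟨P • x, B.Dx_smul_mem hP hx, rfl⟩

/-- The class in `V_k(M) / t V_{k+1}(M)` of an element of `F_{d,k}(M)`. -/
def cls {d k : ℤ} {x : M} (hx : x ∈ B.F d k) : B.VQ k := Submodule.Quotient.mk ⟨x, d, hx⟩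

lemma cls_mem {d k : ℤ} {x : M} (hx : x ∈ B.F d k) : B.cls hx ∈ (B.filVQ k).F d :=
  ⟨⟨x, d, hx⟩, hx, rfl⟩

/-- The filtration of `M / tM` by `F_d(M / tM) = F_{d,k}(M) / (F_{d,k}(M) ∩ tM)`, i.e. by the
images of the `F_{d,k}(M)`. -/
def filMt (k : ℤ) : FFiltration n (M ⧸ LinearMap.range (tmul n M)) where
  F d := (B.F d k).map (LinearMap.range (tmul n M)).mkQ.toAddMonoidHom
  mono d := AddSubgroup.map_mono (B.mono_left d k)
  smul_mem := by
    rintro d d' P _ hP ⟨x, hx, rfl⟩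
    exact ⟨P • x, B.Dx_smul_mem hP hx, rfl⟩

end Bifiltration

/-- The free module `𝒟_{x,t}^r[𝐧][𝐦]`:
`F_{d,k} = ⨁ F_{d - n_i, k - m_i}(𝒟_{x,t}) e_i`. -/
def free (n : ℕ) {r : ℕ} (sF sV : Fin r → ℤ) : Bifiltration n (Fin r → Dxt n) where
  F d k :=
    { carrier := {v | ∀ i, v i ∈ FVD n (d - sF i) (k - sV i)}
      add_mem' := fun hx hy i => add_mem (hx i) (hy i)
      zero_mem' := fun i => zero_mem _
      neg_mem' := fun hx i => neg_mem (hx i) }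
  mono_left d k v hv i := ⟨FD_mono (by linarith) (hv i).1, (hv i).2⟩
  mono_right d k v hv i := ⟨(hv i).1, VD_mono (by linarith) (hv i).2⟩
  smul_mem {d k d' k' P v} hP hv i := by
    rw [add_sub_assoc, add_sub_assoc]
    exact mul_mem_FVD hP (hv i)
  exhaustive v := by
    choose d k h using fun i => exists_FVD (v i)
    obtain ⟨D, hD⟩ := (Set.finite_range fun i => d i + sF i).bddAbove
    obtain ⟨K, hK⟩ := (Set.finite_range fun i => k i + sV i).bddAbove
    refine ⟨D, K, fun i => ⟨FD_mono ?_ (h i).1, VD_mono ?_ (h i).2⟩⟩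
    · have := hD ⟨i, rfl⟩
      simp only at this
      linarith
    · have := hK ⟨i, rfl⟩
      simp only at this
      linarith

/-- A linear map of bifiltered `𝒟_{x,t}`-modules is bifiltered if it maps `F_{d,k}` to `F_{d,k}`. -/
def IsBifiltered {n : ℕ} {M M' : Type*} [AddCommGroup M] [Module (Dxt n) M] [AddCommGroup M']
    [Module (Dxt n) M'] (B : Bifiltration n M) (B' : Bifiltration n M') (φ : M →ₗ[Dxt n] M') :
    Prop := ∀ d k, ∀ x ∈ B.F d k, φ x ∈ B'.F d k

/-- A bifiltered free resolution
`⋯ → 𝒟_{x,t}^{r_1}[𝐧^{(1)}][𝐦^{(1)}] → 𝒟_{x,t}^{r_0}[𝐧^{(0)}][𝐦^{(0)}] → M → 0` of a bifiltered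
module: an exact sequence which induces for all `d`, `k` an exact sequence on the `F_{d,k}`. -/
structure BifilteredFreeResolution {n : ℕ} {M : Type*} [AddCommGroup M] [Module (Dxt n) M]
    (B : Bifiltration n M) where
  r : ℕ → ℕ
  sF : ∀ i, Fin (r i) → ℤ
  sV : ∀ i, Fin (r i) → ℤ
  ψ : ∀ i, (Fin (r (i + 1)) → Dxt n) →ₗ[Dxt n] (Fin (r i) → Dxt n)
  ε : (Fin (r 0) → Dxt n) →ₗ[Dxt n] M
  ψ_bifiltered : ∀ i, IsBifiltered (free n (sF (i + 1)) (sV (i + 1))) (free n (sF i) (sV i)) (ψ i)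
  ε_bifiltered : IsBifiltered (free n (sF 0) (sV 0)) B ε
  ε_surjective : Function.Surjective ε
  exact_zero : Function.Exact (ψ 0) ε
  exact_succ : ∀ i, Function.Exact (ψ (i + 1)) (ψ i)
  F_surjective : ∀ d k, ∀ x ∈ B.F d k, ∃ y ∈ (free n (sF 0) (sV 0)).F d k, ε y = x
  F_exact_zero : ∀ d k, ∀ x ∈ (free n (sF 0) (sV 0)).F d k, ε x = 0 →
    ∃ y ∈ (free n (sF 1) (sV 1)).F d k, ψ 0 y = x
  F_exact_succ : ∀ i d k, ∀ x ∈ (free n (sF (i + 1)) (sV (i + 1))).F d k, ψ i x = 0 →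
    ∃ y ∈ (free n (sF (i + 2)) (sV (i + 2))).F d k, ψ (i + 1) y = x

/-- The `i`-th term of a bifiltered free resolution, with its bifiltration. -/
abbrev BifilteredFreeResolution.L {n : ℕ} {M : Type*} [AddCommGroup M] [Module (Dxt n) M]
    {B : Bifiltration n M} (R : BifilteredFreeResolution B) (i : ℕ) :
    Bifiltration n (Fin (R.r i) → Dxt n) := free n (R.sF i) (R.sV i)

section Induced

variable {n : ℕ} {M M' : Type*} [AddCommGroup M] [Module (Dxt n) M] [AddCommGroup M']
  [Module (Dxt n) M'] {B : Bifiltration n M} {B' : Bifiltration n M'} {φ : M →ₗ[Dxt n] M'}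

lemma IsBifiltered.map_V (hφ : IsBifiltered B B' φ) (k : ℤ) {x : M} (hx : x ∈ B.V k) :
    φ.restrictScalars (Dx n) x ∈ B'.V k := by
  obtain ⟨d, hx⟩ := hx
  exact ⟨d, hφ d k x hx⟩

lemma IsBifiltered.map_tV (hφ : IsBifiltered B B' φ) (k : ℤ) {x : M} (hx : x ∈ B.tV k) :
    φ.restrictScalars (Dx n) x ∈ B'.tV k := by
  obtain ⟨y, hy, rfl⟩ := hx
  exact ⟨φ y, hφ.map_V (k + 1) hy, (φ.map_smul (t n) y).symm⟩

/-- The map `V_k(M) / t V_{k+1}(M) → V_k(M') / t V_{k+1}(M')` induced by a bifiltered map. -/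
def mapVQ (hφ : IsBifiltered B B' φ) (k : ℤ) : B.VQ k →ₗ[Dx n] B'.VQ k :=
  Submodule.mapQ _ _ ((φ.restrictScalars (Dx n)).restrict fun _ hx => hφ.map_V k hx)
    fun _ hx => hφ.map_tV k hx

/-- The map `V_k(M) / t V_{k+1}(M) → M' / tM'` induced by a bifiltered map `M → M'`. -/
def augVQ (hφ : IsBifiltered B B' φ) (k : ℤ) :
    B.VQ k →ₗ[Dx n] M' ⧸ LinearMap.range (tmul n M') :=
  Submodule.liftQ _
    ((LinearMap.range (tmul n M')).mkQ ∘ₗ φ.restrictScalars (Dx n) ∘ₗ (B.V k).subtype)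
    fun x hx => by
      obtain ⟨y, -, hy⟩ := hφ.map_tV k hx
      exact (Submodule.Quotient.mk_eq_zero _).2 ⟨y, hy⟩

lemma mapVQ_isFiltered (hφ : IsBifiltered B B' φ) (k : ℤ) :
    IsFiltered (B.filVQ k) (B'.filVQ k) (mapVQ hφ k) := by
  rintro d _ ⟨x, hx, rfl⟩
  exact ⟨⟨φ x, hφ.map_V k x.2⟩, hφ d k x hx, rfl⟩

lemma augVQ_isFiltered (hφ : IsBifiltered B B' φ) (k : ℤ) :
    IsFiltered (B.filVQ k) (B'.filMt k) (augVQ hφ k) := by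
  rintro d _ ⟨x, hx, rfl⟩
  exact ⟨φ x, hφ d k x hx, rfl⟩

end Induced

/-! ### Filtered free resolutions of filtered `𝒟`-modules -/

/-- The filtered `𝒟`-module `N` is isomorphic to some `𝒟^r[𝐧]`, where
`F_d(𝒟^r[𝐧]) = ⨁ F_{d - n_i}(𝒟) e_i`. -/
def IsFilteredFree {n : ℕ} {N : Type*} [AddCommGroup N] [Module (Dx n) N]
    (Φ : FFiltration n N) : Prop :=
  ∃ (r : ℕ) (s : Fin r → ℤ) (e : (Fin r → Dx n) ≃ₗ[Dx n] N),
    ∀ d v, e v ∈ Φ.F d ↔ ∀ i, v i ∈ FDx n (d - s i)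

/-- `⋯ → C_1 → C_0 → N → 0` is an `F`-filtered free resolution of the filtered `𝒟`-module `N`. -/
structure IsFilteredFreeResolution {n : ℕ} {C : ℕ → Type*} [∀ i, AddCommGroup (C i)]
    [∀ i, Module (Dx n) (C i)] {N : Type*} [AddCommGroup N] [Module (Dx n) N]
    (Φ : ∀ i, FFiltration n (C i)) (Ψ : FFiltration n N)
    (δ : ∀ i, C (i + 1) →ₗ[Dx n] C i) (η : C 0 →ₗ[Dx n] N) : Prop where
  exhaustive : Ψ.IsExhaustive
  free : ∀ i, IsFilteredFree (Φ i)
  δ_filtered : ∀ i, IsFiltered (Φ (i + 1)) (Φ i) (δ i)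
  η_filtered : IsFiltered (Φ 0) Ψ η
  surjective : Function.Surjective η
  exact_zero : Function.Exact (δ 0) η
  exact_succ : ∀ i, Function.Exact (δ (i + 1)) (δ i)
  F_surjective : ∀ d, ∀ x ∈ Ψ.F d, ∃ y ∈ (Φ 0).F d, η y = x
  F_exact_zero : ∀ d, ∀ x ∈ (Φ 0).F d, η x = 0 → ∃ y ∈ (Φ 1).F d, δ 0 y = x
  F_exact_succ : ∀ i d, ∀ x ∈ (Φ (i + 1)).F d, δ i x = 0 → ∃ y ∈ (Φ (i + 2)).F d, δ (i + 1) y = x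

/-! ### Homogenization -/

instance (n : ℕ) : SetLike.GradedMonoid (FDx n) where
  one_mem := one_mem_FD n
  mul_mem _ _ _ _ hP hQ := mul_mem_FD hP hQ

/-- The homogenization (Rees) ring `𝐑𝒟 = ⨁_d F_d(𝒟) T^d`. -/
def RD (n : ℕ) : Type := ⨁ d : ℤ, FDx n d

instance (n : ℕ) : Ring (RD n) := inferInstanceAs (Ring (⨁ d : ℤ, FDx n d))

/-- The degree `d` part `F_d(𝒟) T^d` of `𝐑𝒟`. -/
def RD.grade (n : ℕ) (d : ℤ) : AddSubgroup (RD n) :=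
  (DirectSum.of (fun d => FDx n d) d).range

instance {n : ℕ} {N : Type*} [AddCommGroup N] [Module (Dx n) N] (Φ : FFiltration n N) :
    SetLike.GradedSMul (FDx n) Φ.F where
  smul_mem _ _ _ _ hP hx := Φ.smul_mem hP hx

/-- The homogenization `𝐑N = ⨁_d F_d(N) T^d` of a filtered `𝒟`-module, an `𝐑𝒟`-module. -/
def Rees {n : ℕ} {N : Type*} [AddCommGroup N] [Module (Dx n) N] (Φ : FFiltration n N) :
    Type _ := ⨁ d : ℤ, Φ.F d

instance {n : ℕ} {N : Type*} [AddCommGroup N] [Module (Dx n) N] (Φ : FFiltration n N) :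
    AddCommGroup (Rees Φ) := inferInstanceAs (AddCommGroup (⨁ d : ℤ, Φ.F d))

instance {n : ℕ} {N : Type*} [AddCommGroup N] [Module (Dx n) N] (Φ : FFiltration n N) :
    Module (RD n) (Rees Φ) := inferInstanceAs (Module (⨁ d : ℤ, FDx n d) (⨁ d : ℤ, Φ.F d))

section Rees

variable {n : ℕ} {N N' : Type*} [AddCommGroup N] [Module (Dx n) N] [AddCommGroup N']
  [Module (Dx n) N']

/-- The homogeneous element `x T^d` of `𝐑N`, for `x ∈ F_d(N)`. -/
def Rees.of (Φ : FFiltration n N) (d : ℤ) (x : N) (hx : x ∈ Φ.F d) : Rees Φ :=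
  DirectSum.of (fun d => Φ.F d) d ⟨x, hx⟩

/-- The coefficient of `T^d` of an element of `𝐑N`. -/
def Rees.coeff (Φ : FFiltration n N) (d : ℤ) : Rees Φ →+ N :=
  (Φ.F d).subtype.comp (DFinsupp.evalAddMonoidHom d)

lemma Rees.ext {Φ : FFiltration n N} {x y : Rees Φ}
    (h : ∀ d, Rees.coeff Φ d x = Rees.coeff Φ d y) : x = y :=
  DFinsupp.ext fun d => Subtype.ext (h d)

/-- The map `F_d(N) → F_d(N')` induced by a filtered map. -/
def IsFiltered.restr {Φ : FFiltration n N} {Φ' : FFiltration n N'} {φ : N →ₗ[Dx n] N'}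
    (hφ : IsFiltered Φ Φ' φ) (d : ℤ) : Φ.F d →+ Φ'.F d where
  toFun x := ⟨φ x, hφ d x x.2⟩
  map_zero' := Subtype.ext φ.map_zero
  map_add' _ _ := Subtype.ext (φ.map_add _ _)

lemma Rees.map_smul_aux {Φ : FFiltration n N} {Φ' : FFiltration n N'} {φ : N →ₗ[Dx n] N'}
    (hφ : IsFiltered Φ Φ' φ) (a : ⨁ d : ℤ, FDx n d) (x : ⨁ d : ℤ, Φ.F d) :
    DirectSum.map hφ.restr (a • x) = a • DirectSum.map hφ.restr x := by
  induction a using DirectSum.induction_on with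
  | zero => simp only [zero_smul, map_zero]
  | add a b ha hb => simp only [add_smul, map_add, ha, hb]
  | of d P =>
    induction x using DirectSum.induction_on with
    | zero => simp only [smul_zero, map_zero]
    | add x y hx hy => simp only [smul_add, map_add, hx, hy]
    | of e x =>
      rw [DirectSum.Gmodule.of_smul_of, DirectSum.map_of, DirectSum.map_of,
        DirectSum.Gmodule.of_smul_of]
      congr 1
      exact Subtype.ext (φ.map_smul _ _)

/-- The homogenization `𝐑φ : 𝐑N → 𝐑N'`, `x T^d ↦ φ(x) T^d`, of a filtered map. -/
def Rees.map {Φ : FFiltration n N} {Φ' : FFiltration n N'} {φ : N →ₗ[Dx n] N'}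
    (hφ : IsFiltered Φ Φ' φ) : Rees Φ →ₗ[RD n] Rees Φ' where
  toFun := DirectSum.map hφ.restr
  map_add' := map_add (DirectSum.map hφ.restr)
  map_smul' := Rees.map_smul_aux hφ

lemma Rees.coeff_map {Φ : FFiltration n N} {Φ' : FFiltration n N'} {φ : N →ₗ[Dx n] N'}
    (hφ : IsFiltered Φ Φ' φ) (d : ℤ) (x : Rees Φ) :
    Rees.coeff Φ' d (Rees.map hφ x) = φ (Rees.coeff Φ d x) := rfl

/-- The degree `d` part `F_d(N) T^d` of `𝐑N`. -/
def Rees.grade (Φ : FFiltration n N) (d : ℤ) : AddSubgroup (Rees Φ) :=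
  (DirectSum.of (fun d => Φ.F d) d).range

end Rees

/-- The `𝐑𝒟`-module `Q` with the family `G` of subgroups is isomorphic, as a graded module, to some
`(𝐑𝒟)^r[𝐧]`, whose part of degree `d` is `⨁ F_{d - n_i}(𝒟) T^{d - n_i} e_i`. -/
def IsGradedFree {n : ℕ} {Q : Type*} [AddCommGroup Q] [Module (RD n) Q]
    (G : ℤ → AddSubgroup Q) : Prop :=
  ∃ (r : ℕ) (s : Fin r → ℤ) (e : (Fin r → RD n) ≃ₗ[RD n] Q), ∀ d v,
    e v ∈ G d ↔ ∀ i, v i ∈ RD.grade n (d - s i)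

/-- `⋯ → C_1 → C_0 → N → 0` is a graded free resolution of the graded `𝐑𝒟`-module `N`. -/
structure IsGradedFreeResolution (n : ℕ) {C : ℕ → Type*} [∀ i, AddCommGroup (C i)]
    [∀ i, Module (RD n) (C i)] {N : Type*} [AddCommGroup N] [Module (RD n) N]
    (G : ∀ i, ℤ → AddSubgroup (C i)) (H : ℤ → AddSubgroup N)
    (δ : ∀ i, C (i + 1) →ₗ[RD n] C i) (η : C 0 →ₗ[RD n] N) : Prop where
  free : ∀ i, IsGradedFree (n := n) (G i)
  δ_graded : ∀ i d, ∀ x ∈ G (i + 1) d, δ i x ∈ G i d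
  η_graded : ∀ d, ∀ x ∈ G 0 d, η x ∈ H d
  surjective : Function.Surjective η
  exact_zero : Function.Exact (δ 0) η
  exact_succ : ∀ i, Function.Exact (δ (i + 1)) (δ i)

namespace Bifiltration

variable {n : ℕ} {M : Type*} [AddCommGroup M] [Module (Dxt n) M] (B : Bifiltration n M)

/-- `V_k(𝐑M) = ⨁_d F_{d,k}(M) T^d`. -/
abbrev VR (k : ℤ) : Type _ := Rees (B.level k)

/-- Multiplication by `t`, from `V_{k+1}(𝐑M)` to `V_k(𝐑M)`. -/
def tR (k : ℤ) : B.VR (k + 1) →ₗ[RD n] B.VR k :=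
  Rees.map (Φ := B.level (k + 1)) (Φ' := B.level k) (φ := tmul n M) fun _ _ hx => B.t_smul_mem hx

/-- The `𝐑𝒟`-module `V_k(𝐑M) / t V_{k+1}(𝐑M)`. -/
abbrev VRQ (k : ℤ) : Type _ := B.VR k ⧸ LinearMap.range (B.tR k)

/-- The degree `d` part of `V_k(𝐑M) / t V_{k+1}(𝐑M)`. -/
def gradeVRQ (k d : ℤ) : AddSubgroup (B.VRQ k) :=
  (Rees.grade (B.level k) d).map (LinearMap.range (B.tR k)).mkQ.toAddMonoidHom

end Bifiltration

section InducedRees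

variable {n : ℕ} {M M' : Type*} [AddCommGroup M] [Module (Dxt n) M] [AddCommGroup M']
  [Module (Dxt n) M'] {B : Bifiltration n M} {B' : Bifiltration n M'} {φ : M →ₗ[Dxt n] M'}

/-- The map `V_k(𝐑M) → V_k(𝐑M')` induced by a bifiltered map. -/
def mapVR (hφ : IsBifiltered B B' φ) (k : ℤ) : B.VR k →ₗ[RD n] B'.VR k :=
  Rees.map (Φ := B.level k) (Φ' := B'.level k) (φ := φ.restrictScalars (Dx n))
    fun d x hx => hφ d k x hx

lemma mapVR_tR (hφ : IsBifiltered B B' φ) (k : ℤ) (x : B.VR (k + 1)) :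
    mapVR hφ k (B.tR k x) = B'.tR k (mapVR hφ (k + 1) x) :=
  Rees.ext fun _ => φ.map_smul (t n) _

/-- The map `V_k(𝐑M) / t V_{k+1}(𝐑M) → V_k(𝐑M') / t V_{k+1}(𝐑M')` induced by a bifiltered map. -/
def mapVRQ (hφ : IsBifiltered B B' φ) (k : ℤ) : B.VRQ k →ₗ[RD n] B'.VRQ k :=
  Submodule.mapQ _ _ (mapVR hφ k) (by
    rintro _ ⟨x, rfl⟩
    exact ⟨mapVR hφ (k + 1) x, (mapVR_tR hφ k x).symm⟩)

lemma mkQ_isFiltered (B : Bifiltration n M) (k : ℤ) :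
    IsFiltered (B.level k) (B.filMt k) (LinearMap.range (tmul n M)).mkQ :=
  fun _ x hx => ⟨x, hx, rfl⟩

/-- The map `V_k(𝐑M) / t V_{k+1}(𝐑M) → 𝐑(M' / tM')` induced by a bifiltered map `M → M'`, where
`M' / tM'` is filtered by the images of the `F_{d,k}(M')`. -/
def augVRQ (hφ : IsBifiltered B B' φ) (k : ℤ) : B.VRQ k →ₗ[RD n] Rees (B'.filMt k) :=
  Submodule.liftQ _ (Rees.map (mkQ_isFiltered B' k) ∘ₗ mapVR hφ k) (by
    rintro _ ⟨x, rfl⟩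
    rw [LinearMap.mem_ker, LinearMap.comp_apply, mapVR_tR]
    exact Rees.ext fun _ => (Submodule.Quotient.mk_eq_zero _).2 ⟨_, rfl⟩)

end InducedRees

end FilteredRestriction

end

noncomputable section

namespace FilteredRestriction

/-! ### Normal forms of differential operators -/

section NormalForm

variable {n : ℕ}

/-! Everything about the free modules rests on normal forms. An operator is uniquely a finite sum `∑
a_β ∂^β`, and both `F_d` and `V_k` can be read off the coefficients (`nf_injective`,
`nf_mem_FD_iff`, `nf_mem_VD_iff`). Since `ℂ{x,t}` is a domain, left multiplication by `t` is
injective and preserves the exact order, so `t y ∈ F_d` forces `y ∈ F_d`. This is assertion 1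
(`free_F_inf_tV`). Writing each coefficient as its value at `t = 0` plus a multiple of `t` shows
that `V_k(L)/tV_{k+1}(L)` is filtered free on the classes `∂_t^ν e_i`, `0 ≤ ν ≤ k - m_i`, in degree
`n_i + ν` (`isFilteredFree_free_filVQ`).

For exactness, an element whose image is `t y` is corrected by `t z`, with `z` a lift of `y` in the
same filtration step, and then lifted through the given resolution. At the terms `L_i`, `i ≥ 1`,
this needs only assertion 1 and injectivity of `t`. At `L_0` and `M/tM` two facts about `M` are
needed: `M = V_{k₁} + tM`, and `tm ∈ V_{k₁}` implies `tm ∈ tV_{k₁+1}`. They come from `b`.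

Put `A = t∂_t + k`. Then `b(A) = b(k) + t∂_t q(A)`, so where `b(A)` lowers the index and `b(k) ≠ 0`,
an element of index `k` has index `k - 1` modulo `tM`. Likewise `b(A + 1) = b(k) + q(A + 1) ∂_t t`,
so `tx` of low index forces `x` of lower index. The difficulty is that for `k > 0` nothing is
assumed about `b(t∂_t + k)` on `V_k(M)`. There `V_k` is replaced by `U_k = ∑_{j ≤ k} ∂_t^j V_0`
(`VGen`), which is exhaustive because `M = 𝒟_{x,t}V_0`, and which inherits the property at `0` from
`b(t∂_t + k + 1)∂_t = ∂_t b(t∂_t + k)`. To return from `U` to `V`, the descent is run with a second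
family recording where the multiples of `t` lie.

For homogenization, `𝐑(V_k/tV_{k+1})` and `V_k(𝐑L)/tV_{k+1}(𝐑L)` are quotients of the same Rees
module, and assertion 1 says that the two kernels agree. Exactness and freeness then pass from
filtered to graded objects degree by degree. -/

lemma germ_add (a b : O n) : germ (a + b) = germ a + germ b :=
  act_injective n (map_add (Algebra.lmul ℂ (O n)) a b)

lemma germ_zero : germ (0 : O n) = 0 := act_injective n (map_zero (Algebra.lmul ℂ (O n)))

lemma germ_smul (c : ℂ) (a : O n) : germ (c • a) = c • germ a :=
  act_injective n (map_smul (Algebra.lmul ℂ (O n)) c a)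

lemma ser_injective : Function.Injective (ser : O n → MvPowerSeries (Fin (n + 1)) ℂ) :=
  Subtype.val_injective

lemma act_germ (a f : O n) : act n (germ a) f = a * f := rfl

lemma act_del (i : Fin (n + 1)) (f : O n) : act n (del i) f = pdv i f := rfl

lemma act_mul_apply (P Q : Dxt n) (f : O n) : act n (P * Q) f = act n P (act n Q f) := by
  rw [map_mul]; rfl

lemma del_comm (i j : Fin (n + 1)) : Commute (del i : Dxt n) (del j) := by
  classical
  apply act_injective n
  ext f : 1
  rw [act_mul_apply, act_mul_apply]
  apply ser_injective
  simp only [act_del, coe_pdv]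
  ext α
  simp only [MvPowerSeries.coeff_pderiv, Finsupp.add_apply, Finsupp.single_apply]
  rw [add_right_comm]
  rcases eq_or_ne i j with rfl | h
  · rfl
  · rw [if_neg h, if_neg h.symm]
    push_cast
    ring

/-- The operator `∂^β`. -/
def dpow (β : Fin (n + 1) →₀ ℕ) : Dxt n := ((Finsupp.toMultiset β).toList.map del).prod

lemma prod_map_del (w : List (Fin (n + 1))) :
    (w.map del).prod = dpow (n := n) (Multiset.toFinsupp (w : Multiset (Fin (n + 1)))) := by
  rw [dpow]
  refine List.Perm.prod_eq' (List.Perm.map _ ?_) ?_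
  · rw [← Multiset.coe_eq_coe, Multiset.coe_toList]
    exact (Multiset.toFinsupp_toMultiset _).symm
  · refine List.pairwise_of_forall_mem_list fun a ha b hb => ?_
    obtain ⟨i, -, rfl⟩ := List.mem_map.1 ha
    obtain ⟨j, -, rfl⟩ := List.mem_map.1 hb
    exact del_comm i j

lemma dpow_add (β γ : Fin (n + 1) →₀ ℕ) : dpow (β + γ) = dpow β * dpow γ := by
  conv_rhs => rw [dpow, dpow, ← List.prod_append, ← List.map_append, prod_map_del]
  rw [← Multiset.coe_add, Multiset.coe_toList, Multiset.coe_toList, ← map_add,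
    Finsupp.toMultiset_toFinsupp]

lemma dpow_single (i : Fin (n + 1)) : dpow (Finsupp.single i 1) = del (n := n) i := by
  have := prod_map_del (n := n) [i]
  simpa using this.symm

lemma dpow_zero : dpow (0 : Fin (n + 1) →₀ ℕ) = 1 := by simp [dpow]

lemma mono_eq_germ_mul_dpow (a : O n) (w : List (Fin (n + 1))) :
    mono a w = germ a * dpow (Multiset.toFinsupp (w : Multiset (Fin (n + 1)))) := by
  rw [mono, prod_map_del]

/-- A derivative shifts the exponents and multiplies by a product of positive integers. The constant
does not depend on `f`, and only its being non-zero matters later. -/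
lemma coeff_act_prod_map_del (w : List (Fin (n + 1))) (α : Fin (n + 1) →₀ ℕ) :
    ∃ N : ℂ, N ≠ 0 ∧ ∀ f : O n, MvPowerSeries.coeff α (ser (act n (w.map del).prod f)) =
      N * MvPowerSeries.coeff (α + Multiset.toFinsupp (w : Multiset (Fin (n + 1)))) (ser f) := by
  induction w generalizing α with
  | nil => exact ⟨1, one_ne_zero, fun f => by simp⟩
  | cons i w ih =>
    obtain ⟨N, hN, h⟩ := ih (α + Finsupp.single i 1)
    refine ⟨N * (α i + 1), mul_ne_zero hN (Nat.cast_add_one_ne_zero _), fun f => ?_⟩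
    rw [List.map_cons, List.prod_cons, act_mul_apply, act_del, coe_pdv,
      MvPowerSeries.coeff_pderiv, h, ← Multiset.cons_coe, ← Multiset.singleton_add, map_add,
      Multiset.toFinsupp_singleton, add_assoc]
    ring

lemma coeff_act_dpow (β α : Fin (n + 1) →₀ ℕ) :
    ∃ N : ℂ, N ≠ 0 ∧ ∀ f : O n, MvPowerSeries.coeff α (ser (act n (dpow β) f)) =
      N * MvPowerSeries.coeff (α + β) (ser f) := by
  have h := coeff_act_prod_map_del (n := n) (Finsupp.toMultiset β).toList α
  rwa [Multiset.coe_toList, Finsupp.toMultiset_toFinsupp] at h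

/-- The monomial `z^β` as a convergent power series. -/
def monoO (β : Fin (n + 1) →₀ ℕ) : O n :=
  ⟨MvPowerSeries.monomial β 1, 1, 1, fun α => by
    classical
    rw [MvPowerSeries.coeff_monomial]
    split_ifs <;> simp⟩

lemma coeff_monoO (β α : Fin (n + 1) →₀ ℕ) :
    MvPowerSeries.coeff α (ser (monoO β : O n)) = if α = β then 1 else 0 :=
  MvPowerSeries.coeff_monomial α β (1 : ℂ)

/-- `germ` as a linear map. -/
def germL : O n →ₗ[ℂ] Dxt n where
  toFun := germ
  map_add' := germ_add
  map_smul' := germ_smul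

/-- The operator `∑ a_β ∂^β` with coefficients `a_β`. -/
def nf : ((Fin (n + 1) →₀ ℕ) →₀ O n) →ₗ[ℂ] Dxt n :=
  Finsupp.lsum ℂ fun β => LinearMap.mulRight ℂ (dpow β) ∘ₗ germL

lemma nf_apply (a : (Fin (n + 1) →₀ ℕ) →₀ O n) :
    nf a = a.sum fun β c => germ c * dpow β := rfl

lemma nf_single (β : Fin (n + 1) →₀ ℕ) (c : O n) :
    nf (Finsupp.single β c) = germ c * dpow β := by
  rw [nf_apply, Finsupp.sum_single_index (by rw [germ_zero, zero_mul])]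

lemma act_nf (a : (Fin (n + 1) →₀ ℕ) →₀ O n) (f : O n) :
    act n (nf a) f = ∑ β ∈ a.support, a β * act n (dpow β) f := by
  rw [nf_apply, Finsupp.sum, map_sum, LinearMap.sum_apply]
  refine Finset.sum_congr rfl fun β _ => ?_
  rw [act_mul_apply, act_germ]

/-- Induction on `|β|`, testing on `z^β`. Coefficients of lower degree are already zero, a `∂^γ`
with `|γ| ≥ |β|` and `γ ≠ β` kills `z^β`, and `∂^β z^β` is a non-zero constant, so `a_β` vanishes.
-/
lemma eq_zero_of_act_nf (a : (Fin (n + 1) →₀ ℕ) →₀ O n)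
    (h : ∀ β, act n (nf a) (monoO β) = 0) : a = 0 := by
  classical
  suffices H : ∀ m : ℕ, ∀ β : Fin (n + 1) →₀ ℕ, β.degree = m → a β = 0 from
    Finsupp.ext fun β => H _ β rfl
  intro m
  induction m using Nat.strong_induction_on with
  | _ m ih =>
    intro β hβ
    by_contra hne
    have h1 := h β
    rw [act_nf, Finset.sum_eq_single β] at h1
    · obtain ⟨N, hN, hN'⟩ := coeff_act_dpow (n := n) β 0
      have hser : ser (act n (dpow β) (monoO β)) = MvPowerSeries.C N := by
        ext α
        rw [MvPowerSeries.coeff_C]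
        split_ifs with hα
        · subst hα
          rw [hN', coeff_monoO, if_pos (zero_add _), mul_one]
        · obtain ⟨N', -, hN''⟩ := coeff_act_dpow (n := n) β α
          rw [hN'', coeff_monoO, if_neg (by simpa using hα), mul_zero]
      have h2 := congrArg ser h1
      rw [map_mul, hser, map_zero, mul_comm, ← MvPowerSeries.smul_eq_C_mul] at h2
      have h3 := (smul_eq_zero.1 h2).resolve_left hN
      exact hne (ser_injective (h3.trans (map_zero ser).symm))
    · intro γ hγ hγβ
      have hdeg : β.degree ≤ γ.degree := by
        by_contra hlt
        exact (Finsupp.mem_support_iff.1 hγ) (ih _ (by omega) γ rfl)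
      have : act n (dpow γ) (monoO β) = 0 := by
        apply ser_injective
        ext α
        obtain ⟨N', -, hN''⟩ := coeff_act_dpow (n := n) γ α
        rw [hN'', coeff_monoO, if_neg, mul_zero, map_zero, map_zero]
        rintro rfl
        rw [map_add] at hdeg
        have h0 : α.degree = 0 := by omega
        rw [Finsupp.degree_eq_zero_iff] at h0
        exact hγβ (by simp [h0])
      rw [this, mul_zero]
    · intro hβ'
      exact absurd (Finsupp.notMem_support_iff.1 hβ') hne

lemma nf_injective : Function.Injective (nf (n := n)) := by
  rw [← LinearMap.ker_eq_bot, LinearMap.ker_eq_bot']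
  intro a ha
  exact eq_zero_of_act_nf a fun β => by rw [ha, map_zero]; rfl

lemma exists_nf_of_mem_FD {d : ℤ} {P : Dxt n} (hP : P ∈ FD n d) :
    ∃ a, nf a = P ∧ ∀ β, a β ≠ 0 → (β.degree : ℤ) ≤ d := by
  classical
  induction hP using Submodule.span_induction with
  | mem P h =>
    obtain ⟨a, w, hw, rfl⟩ := h
    refine ⟨Finsupp.single (Multiset.toFinsupp (w : Multiset (Fin (n + 1)))) a, ?_,
      fun β hβ => ?_⟩
    · rw [nf_single, mono_eq_germ_mul_dpow]
    · rw [Finsupp.single_apply] at hβ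
      have : β = Multiset.toFinsupp (w : Multiset (Fin (n + 1))) := by
        by_contra h
        exact hβ (if_neg (Ne.symm h))
      have h2 : β.degree = w.length := by
        rw [← Multiset.coe_card, ← Multiset.toFinsupp_toMultiset (w : Multiset (Fin (n + 1))), ← this,
          Finsupp.card_toMultiset, Finsupp.degree_apply, Finsupp.sum]; rfl
      rw [h2]
      exact hw
  | zero => exact ⟨0, map_zero _, fun β h => absurd rfl h⟩
  | add x y _ _ hx hy =>
    obtain ⟨a, rfl, ha⟩ := hx
    obtain ⟨b, rfl, hb⟩ := hy
    refine ⟨a + b, map_add _ _ _, fun β hβ => ?_⟩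
    by_cases h : a β = 0
    · refine hb β fun h' => hβ ?_
      rw [Finsupp.add_apply, h, h', add_zero]
    · exact ha β h
  | smul c x _ hx =>
    obtain ⟨a, rfl, ha⟩ := hx
    refine ⟨c • a, map_smul _ _ _, fun β hβ => ha β fun h => hβ ?_⟩
    rw [Finsupp.smul_apply, h, smul_zero]

lemma exists_nf_of_mem_VD {k : ℤ} {P : Dxt n} (hP : P ∈ VD n k) :
    ∃ a, nf a = P ∧ ∀ β α, MvPowerSeries.coeff α (ser (a β)) ≠ 0 →
      (β (Fin.last n) : ℤ) - α (Fin.last n) ≤ k := by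
  classical
  induction hP using Submodule.span_induction with
  | mem P h =>
    obtain ⟨a, w, hw, rfl⟩ := h
    refine ⟨Finsupp.single (Multiset.toFinsupp (w : Multiset (Fin (n + 1)))) a, ?_,
      fun β α hβ => ?_⟩
    · rw [nf_single, mono_eq_germ_mul_dpow]
    · rw [Finsupp.single_apply] at hβ
      split_ifs at hβ with h
      · rw [← h, Multiset.toFinsupp_apply, Multiset.coe_count]
        exact hw α hβ
      · simp at hβ
  | zero => exact ⟨0, map_zero _, fun β α h => absurd (by simp) h⟩
  | add x y _ _ hx hy =>
    obtain ⟨a, rfl, ha⟩ := hx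
    obtain ⟨b, rfl, hb⟩ := hy
    refine ⟨a + b, map_add _ _ _, fun β α hβ => ?_⟩
    by_cases h : MvPowerSeries.coeff α (ser (a β)) = 0
    · refine hb β α fun h' => hβ ?_
      rw [Finsupp.add_apply, map_add, map_add, h, h', add_zero]
    · exact ha β α h
  | smul c x _ hx =>
    obtain ⟨a, rfl, ha⟩ := hx
    refine ⟨c • a, map_smul _ _ _, fun β α hβ => ha β α fun h => hβ ?_⟩
    rw [Finsupp.smul_apply, map_smul, map_smul, h, smul_zero]

lemma germ_mul_dpow_eq_mono (c : O n) (β : Fin (n + 1) →₀ ℕ) :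
    germ c * dpow β = mono c (Finsupp.toMultiset β).toList := by
  rw [mono_eq_germ_mul_dpow, Multiset.coe_toList, Finsupp.toMultiset_toFinsupp]

lemma germ_mul_dpow_mem_FD (c : O n) {β : Fin (n + 1) →₀ ℕ} {d : ℤ} (h : (β.degree : ℤ) ≤ d) :
    germ c * dpow β ∈ FD n d := by
  refine Submodule.subset_span ⟨c, _, ?_, germ_mul_dpow_eq_mono c β⟩
  rwa [Multiset.length_toList, Finsupp.card_toMultiset]

lemma germ_mul_dpow_mem_VD (c : O n) {β : Fin (n + 1) →₀ ℕ} {k : ℤ}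
    (h : ∀ α, MvPowerSeries.coeff α (ser c) ≠ 0 →
      (β (Fin.last n) : ℤ) - α (Fin.last n) ≤ k) :
    germ c * dpow β ∈ VD n k := by
  classical
  refine Submodule.subset_span ⟨c, _, fun α hα => ?_, germ_mul_dpow_eq_mono c β⟩
  rw [← Multiset.coe_count, Multiset.coe_toList, Finsupp.count_toMultiset]
  exact h α hα

/-- Membership in the span provides some normal form obeying the bound; uniqueness identifies it
with `a`. -/
lemma nf_mem_FD_iff {d : ℤ} {a : (Fin (n + 1) →₀ ℕ) →₀ O n} :
    nf a ∈ FD n d ↔ ∀ β, a β ≠ 0 → (β.degree : ℤ) ≤ d := by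
  constructor
  · intro h
    obtain ⟨b, hb, h'⟩ := exists_nf_of_mem_FD h
    rwa [← nf_injective hb]
  · intro h
    rw [nf_apply]
    exact sum_mem fun β hβ => germ_mul_dpow_mem_FD _ (h β (Finsupp.mem_support_iff.1 hβ))

lemma nf_mem_VD_iff {k : ℤ} {a : (Fin (n + 1) →₀ ℕ) →₀ O n} :
    nf a ∈ VD n k ↔ ∀ β α, MvPowerSeries.coeff α (ser (a β)) ≠ 0 →
      (β (Fin.last n) : ℤ) - α (Fin.last n) ≤ k := by
  constructor
  · intro h
    obtain ⟨b, hb, h'⟩ := exists_nf_of_mem_VD h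
    rwa [← nf_injective hb]
  · intro h
    rw [nf_apply]
    exact sum_mem fun β _ => germ_mul_dpow_mem_VD _ (h β)

lemma nf_surjective : Function.Surjective (nf (n := n)) := fun P =>
  let ⟨_, _, hP⟩ := exists_FVD P
  let ⟨a, ha, _⟩ := exists_nf_of_mem_FD hP.1
  ⟨a, ha⟩

lemma eq_zero_of_act_monoO {P : Dxt n} (h : ∀ β, act n P (monoO β) = 0) : P = 0 := by
  obtain ⟨a, rfl⟩ := nf_surjective P
  rw [eq_zero_of_act_nf a h, map_zero]

lemma tO_ne_zero : tO n ≠ 0 := by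
  intro h
  have := congrArg ser h
  rw [ser_tO, map_zero] at this
  have h2 := MvPowerSeries.coeff_index_single_self_X (R := ℂ) (Fin.last n)
  rw [this, map_zero] at h2
  exact zero_ne_one h2

instance : NoZeroDivisors (O n) :=
  Function.Injective.noZeroDivisors ser ser_injective (map_zero _) (map_mul _)

/-- Multiplication by `t` on coefficients. -/
def tcoef : ((Fin (n + 1) →₀ ℕ) →₀ O n) →ₗ[ℂ] ((Fin (n + 1) →₀ ℕ) →₀ O n) :=
  Finsupp.mapRange.linearMap (LinearMap.mulLeft ℂ (tO n))

lemma t_mul_nf (a : (Fin (n + 1) →₀ ℕ) →₀ O n) : t n * nf a = nf (tcoef a) := by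
  induction a using Finsupp.induction_linear with
  | zero => simp
  | add a b ha hb => rw [map_add, map_add, map_add, mul_add, ha, hb]
  | single β c =>
    rw [nf_single, ← mul_assoc, t, ← germ_mul, ← nf_single]
    congr 1
    rw [tcoef, Finsupp.mapRange.linearMap_apply, Finsupp.mapRange_single]
    rfl

/-- `t a_β ≠ 0` whenever `a_β ≠ 0`, so `P` and `tP` involve the same `∂^β`. This strictness is the
source of assertion 1. -/
lemma mem_FD_of_t_mul_mem {d : ℤ} {P : Dxt n} (h : t n * P ∈ FD n d) : P ∈ FD n d := by
  obtain ⟨a, rfl⟩ := nf_surjective P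
  rw [t_mul_nf, nf_mem_FD_iff] at h
  rw [nf_mem_FD_iff]
  exact fun β hβ => h β (mul_ne_zero tO_ne_zero hβ)

lemma t_mul_injective : Function.Injective fun P : Dxt n => t n * P := by
  have : Function.Injective (LinearMap.mulLeft ℂ (t n)) := by
    rw [← LinearMap.ker_eq_bot, LinearMap.ker_eq_bot']
    intro P hP
    obtain ⟨a, rfl⟩ := nf_surjective P
    rw [LinearMap.mulLeft_apply, t_mul_nf, ← map_zero nf] at hP
    have h := nf_injective hP
    suffices a = 0 by rw [this, map_zero]
    ext β : 1
    exact (mul_eq_zero.1 (DFunLike.congr_fun h β)).resolve_left tO_ne_zero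
  exact this

end NormalForm

/-! ### Splitting off `t` -/

section Splitting

variable {n : ℕ}

/-- The power series does not involve `t`. -/
def TFree (a : O n) : Prop :=
  ∀ α : Fin (n + 1) →₀ ℕ, MvPowerSeries.coeff α (ser a) ≠ 0 → α (Fin.last n) = 0

lemma coeff_t_mul (f : O n) (α : Fin (n + 1) →₀ ℕ) :
    MvPowerSeries.coeff α (ser (tO n * f)) = if α (Fin.last n) = 0 then 0 else
      MvPowerSeries.coeff (α - Finsupp.single (Fin.last n) 1) (ser f) := by
  classical
  rw [map_mul, ser_tO, MvPowerSeries.X, MvPowerSeries.coeff_monomial_mul, one_mul]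
  by_cases h : α (Fin.last n) = 0
  · rw [if_pos h, if_neg]
    rw [Finsupp.single_le_iff]
    omega
  · rw [if_neg h, if_pos]
    rw [Finsupp.single_le_iff]
    omega

/-- The value of a power series at `t = 0`. -/
def tconst : O n →ₗ[ℂ] O n where
  toFun a := ⟨fun α => if α (Fin.last n) = 0 then MvPowerSeries.coeff α (ser a) else 0, by
    obtain ⟨C, r, h⟩ := a.2
    refine ⟨C, r, fun α => ?_⟩
    change ‖if α (Fin.last n) = 0 then MvPowerSeries.coeff α (ser a) else 0‖₊ ≤ _
    split_ifs
    · exact h α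
    · simp⟩
  map_add' a b := Subtype.ext (funext fun α => by
    change (if α (Fin.last n) = 0 then MvPowerSeries.coeff α (ser (a + b)) else 0) =
      (if α (Fin.last n) = 0 then MvPowerSeries.coeff α (ser a) else 0) +
        if α (Fin.last n) = 0 then MvPowerSeries.coeff α (ser b) else 0
    split_ifs <;> simp)
  map_smul' c a := Subtype.ext (funext fun α => by
    change (if α (Fin.last n) = 0 then MvPowerSeries.coeff α (ser (c • a)) else 0) =
      c * if α (Fin.last n) = 0 then MvPowerSeries.coeff α (ser a) else 0
    split_ifs <;> simp)

lemma coeff_tconst (a : O n) (α : Fin (n + 1) →₀ ℕ) :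
    MvPowerSeries.coeff α (ser (tconst a)) =
      if α (Fin.last n) = 0 then MvPowerSeries.coeff α (ser a) else 0 := rfl

lemma tFree_tconst (a : O n) : TFree (tconst a) := fun α h => by
  by_contra h'
  exact h (by rw [coeff_tconst, if_neg h'])

/-- The power series `(a - a|_{t = 0}) / t`. -/
def tquot : O n →ₗ[ℂ] O n where
  toFun a := ⟨fun α => MvPowerSeries.coeff (α + Finsupp.single (Fin.last n) 1) (ser a), by
    obtain ⟨C, r, h⟩ := a.2
    refine ⟨C * r, r, fun α => ?_⟩
    refine (h (α + Finsupp.single (Fin.last n) 1)).trans (le_of_eq ?_)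
    rw [map_add, Finsupp.degree_single, pow_succ]
    ring⟩
  map_add' a b := Subtype.ext (funext fun α => by
    change MvPowerSeries.coeff (α + Finsupp.single (Fin.last n) 1) (ser (a + b)) =
      MvPowerSeries.coeff (α + Finsupp.single (Fin.last n) 1) (ser a) +
        MvPowerSeries.coeff (α + Finsupp.single (Fin.last n) 1) (ser b)
    simp)
  map_smul' c a := Subtype.ext (funext fun α => by
    change MvPowerSeries.coeff (α + Finsupp.single (Fin.last n) 1) (ser (c • a)) =
      c * MvPowerSeries.coeff (α + Finsupp.single (Fin.last n) 1) (ser a)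
    simp)

lemma coeff_tquot (a : O n) (α : Fin (n + 1) →₀ ℕ) :
    MvPowerSeries.coeff α (ser (tquot a)) =
      MvPowerSeries.coeff (α + Finsupp.single (Fin.last n) 1) (ser a) := rfl

lemma tconst_add_t_mul_tquot (a : O n) : tconst a + tO n * tquot a = a := by
  apply ser_injective
  ext α
  rw [map_add, map_add, coeff_tconst, coeff_t_mul, coeff_tquot]
  split_ifs with h
  · rw [add_zero]
  · rw [zero_add, tsub_add_cancel_of_le]
    rw [Finsupp.single_le_iff]
    omega

lemma eq_zero_of_tFree_t_mul {f : O n} (h : TFree (tO n * f)) : tO n * f = 0 := by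
  apply ser_injective
  ext α
  by_contra hne
  rw [map_zero, map_zero] at hne
  exact hne (by rw [coeff_t_mul, if_pos (h α hne)])

lemma TFree.add {a b : O n} (ha : TFree a) (hb : TFree b) : TFree (a + b) := fun α h => by
  rw [map_add, map_add] at h
  by_cases h' : MvPowerSeries.coeff α (ser a) = 0
  · exact hb α fun h'' => h (by rw [h', h'', add_zero])
  · exact ha α h'

lemma TFree.smul {a : O n} (c : ℂ) (ha : TFree a) : TFree (c • a) := fun α h =>
  ha α fun h' => h (by rw [map_smul, map_smul, h', smul_zero])

lemma TFree.mul {a b : O n} (ha : TFree a) (hb : TFree b) : TFree (a * b) := fun α h => by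
  classical
  rw [map_mul, MvPowerSeries.coeff_mul] at h
  obtain ⟨p, hp, hne⟩ := Finset.exists_ne_zero_of_sum_ne_zero h
  rw [Finset.HasAntidiagonal.mem_antidiagonal] at hp
  rw [← hp, Finsupp.add_apply, ha _ (left_ne_zero_of_mul hne), hb _ (right_ne_zero_of_mul hne)]

lemma TFree.act {P : Dxt n} (hP : P ∈ DxAlg n) {a : O n} (ha : TFree a) :
    TFree (act n P a) := by
  induction hP using Algebra.adjoin_induction generalizing a with
  | mem P h =>
    rcases h with ⟨b, hb, rfl⟩ | ⟨i, rfl⟩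
    · exact TFree.mul hb ha
    · intro α h
      rw [act_del, coe_pdv, MvPowerSeries.coeff_pderiv] at h
      have := ha _ (left_ne_zero_of_mul h)
      rw [Finsupp.add_apply] at this
      omega
  | algebraMap c =>
    rw [Algebra.algebraMap_eq_smul_one, map_smul, map_one]
    exact ha.smul c
  | add x y _ _ hx hy =>
    rw [map_add]
    exact (hx ha).add (hy ha)
  | mul x y _ _ hx hy =>
    rw [act_mul_apply]
    exact hx (hy ha)

lemma pdv_mul (i : Fin (n + 1)) (a b : O n) : pdv i (a * b) = pdv i a * b + a * pdv i b := by
  have h := congrArg (fun P => FilteredRestriction.act n P b) (del_mul_germ i a)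
  simp only [map_add, LinearMap.add_apply, act_mul_apply, act_germ, act_del] at h
  exact h

lemma pdv_last_tO : pdv (Fin.last n) (tO n) = 1 := by
  apply ser_injective
  rw [coe_pdv, ser_tO, MvPowerSeries.pderiv_X_self, map_one]

lemma pdv_last_of_tFree {g : O n} (hg : TFree g) : pdv (Fin.last n) g = 0 := by
  apply ser_injective
  ext α
  rw [coe_pdv, MvPowerSeries.coeff_pderiv, map_zero, map_zero]
  by_contra h
  have := hg _ (left_ne_zero_of_mul h)
  simp at this

lemma pdv_last_pow_mul {g : O n} (hg : TFree g) (j : ℕ) :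
    pdv (Fin.last n) (tO n ^ (j + 1) * g) = ((j : ℂ) + 1) • (tO n ^ j * g) := by
  induction j with
  | zero => simp [pdv_mul, pdv_last_tO, pdv_last_of_tFree hg]
  | succ j ih =>
    rw [pow_succ', mul_assoc, pdv_mul, ih, pdv_last_tO, one_mul, mul_smul_comm, ← mul_assoc,
      ← pow_succ']
    push_cast
    module

lemma act_dt_pow_self {g : O n} (hg : TFree g) (j : ℕ) :
    act n (dt n ^ j) (tO n ^ j * g) = (j.factorial : ℂ) • g := by
  induction j with
  | zero => simp
  | succ j ih =>
    rw [pow_succ (dt n), act_mul_apply, dt, act_del, pdv_last_pow_mul hg, map_smul, ← dt, ih,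
      smul_smul, Nat.factorial_succ]
    push_cast
    rfl

lemma act_dt_pow_of_lt {g : O n} (hg : TFree g) {j ν : ℕ} (h : j < ν) :
    act n (dt n ^ ν) (tO n ^ j * g) = 0 := by
  obtain ⟨m, rfl⟩ := Nat.exists_eq_add_of_lt h
  rw [show j + m + 1 = m + (1 + j) by ring, pow_add, pow_add, act_mul_apply, act_mul_apply,
    act_dt_pow_self hg, pow_one, dt, act_del, pdv_last_of_tFree (hg.smul _), map_zero]

lemma t_mul_monoO (β : Fin (n + 1) →₀ ℕ) :
    tO n * monoO β = monoO (β + Finsupp.single (Fin.last n) 1) := by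
  apply ser_injective
  ext α
  rw [coeff_t_mul, coeff_monoO, coeff_monoO]
  by_cases h : α (Fin.last n) = 0
  · rw [if_pos h, if_neg]
    rintro rfl
    simp at h
  · have h1 : Finsupp.single (Fin.last n) 1 ≤ α := by
      rw [Finsupp.single_le_iff]
      omega
    rw [if_neg h]
    simp only [tsub_eq_iff_eq_add_of_le h1]

lemma tFree_monoO {β : Fin (n + 1) →₀ ℕ} (h : β (Fin.last n) = 0) : TFree (monoO β) :=
  fun α hα => by
    rw [coeff_monoO] at hα
    have : α = β := by
      by_contra h'
      exact hα (if_neg h')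
    rw [this, h]

lemma act_t_mul {P : Dxt n} (hP : P ∈ DxAlg n) (f : O n) :
    act n P (tO n * f) = tO n * act n P f := by
  have h := congrArg (fun Q => act n Q f) (t_comm hP)
  simp only [act_mul_apply, t, act_germ] at h
  exact h.symm

/-- `P` commutes with `t`, so its value on a monomial is a power of `t` times its value on a
monomial in `x` alone. -/
lemma eq_zero_of_act_tFree {P : Dxt n} (hP : P ∈ DxAlg n)
    (h : ∀ g, TFree g → act n P g = 0) : P = 0 := by
  refine eq_zero_of_act_monoO fun β => ?_
  induction hm : β (Fin.last n) generalizing β with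
  | zero => exact h _ (tFree_monoO hm)
  | succ m ih =>
    have h1 : Finsupp.single (Fin.last n) 1 ≤ β := by
      rw [Finsupp.single_le_iff]
      omega
    rw [← tsub_add_cancel_of_le h1, ← t_mul_monoO, act_t_mul hP, ih, mul_zero]
    simp [hm]

lemma incl_injective : Function.Injective (incl n) := Subtype.val_injective

/-- Test on `t^j g(x)`, by induction on `j`: terms with `ν < j` vanish by induction, those with `ν >
j` because `∂_t^ν` kills `t^j g`. What remains is `j! P_j g`, free of `t` and yet divisible by `t`,
hence zero. -/
lemma eq_zero_of_sum_mul_dt_pow_eq {K : ℕ} (P : Fin K → Dx n) (Q : Dxt n)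
    (h : ∑ ν, incl n (P ν) * dt n ^ ν.val = t n * Q) : P = 0 := by
  suffices H : ∀ m : ℕ, ∀ j : Fin K, (j : ℕ) = m → P j = 0 from funext fun j => H _ j rfl
  intro m
  induction m using Nat.strong_induction_on with
  | _ m ih =>
    rintro j rfl
    apply incl_injective
    rw [map_zero]
    refine eq_zero_of_act_tFree (incl_mem _) fun g hg => ?_
    have h1 := congrArg (fun R => act n R (tO n ^ (j : ℕ) * g)) h
    simp only [map_sum, LinearMap.sum_apply] at h1
    rw [Finset.sum_eq_single j] at h1
    · rw [act_mul_apply, act_dt_pow_self hg, map_smul, act_mul_apply, t, act_germ] at h1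
      have h2 := TFree.smul ((j : ℕ).factorial : ℂ) (hg.act (incl_mem (P j)))
      rw [h1] at h2
      rw [eq_zero_of_tFree_t_mul h2] at h1
      exact (smul_eq_zero.1 h1).resolve_left (Nat.cast_ne_zero.2 (Nat.factorial_ne_zero _))
    · intro ν _ hν
      rw [act_mul_apply]
      rcases lt_or_gt_of_ne (Fin.val_ne_of_ne hν) with h' | h'
      · rw [ih _ h' ν rfl, map_zero, map_zero]
        rfl
      · rw [act_dt_pow_of_lt hg h', map_zero]
    · exact fun h => absurd (Finset.mem_univ _) h

lemma dpow_mem_DxAlg {β : Fin (n + 1) →₀ ℕ} (h : β (Fin.last n) = 0) :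
    dpow β ∈ DxAlg n := by
  classical
  refine list_prod_mem fun P hP => ?_
  obtain ⟨i, hi, rfl⟩ := List.mem_map.1 hP
  rw [Multiset.mem_toList, Finsupp.mem_toMultiset, Finsupp.mem_support_iff] at hi
  obtain ⟨j, rfl⟩ := Fin.exists_castSucc_eq.2 (fun h' : i = Fin.last n => hi (h' ▸ h))
  exact Algebra.subset_adjoin (Or.inr ⟨j, rfl⟩)

lemma germ_mem_DxAlg {a : O n} (h : TFree a) : germ a ∈ DxAlg n :=
  Algebra.subset_adjoin (Or.inl ⟨a, h, rfl⟩)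

lemma dpow_single_last (ν : ℕ) : dpow (Finsupp.single (Fin.last n) ν) = dt n ^ ν := by
  induction ν with
  | zero => rw [Finsupp.single_zero, dpow_zero, pow_zero]
  | succ ν ih => rw [Finsupp.single_add, dpow_add, ih, dpow_single, pow_succ, dt]

lemma exists_germ_mul_dpow_eq {a : O n} (ha : TFree a) {β : Fin (n + 1) →₀ ℕ} {d : ℤ}
    (hd : (β.degree : ℤ) ≤ d) : ∃ P ∈ FDx n (d - β (Fin.last n)),
      germ a * dpow β = incl n P * dt n ^ β (Fin.last n) := by
  have hβ := Finsupp.erase_add_single (Fin.last n) β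
  refine ⟨⟨germ a * dpow (β.erase (Fin.last n)),
    mul_mem (germ_mem_DxAlg ha) (dpow_mem_DxAlg Finsupp.erase_same)⟩, ?_, ?_⟩
  · refine germ_mul_dpow_mem_FD a ?_
    have h := congrArg Finsupp.degree hβ
    rw [map_add, Finsupp.degree_single] at h
    omega
  · conv_lhs => rw [← hβ, dpow_add, dpow_single_last, ← mul_assoc]
    rfl

/-- `(k + 1).toNat` counts the `ν` with `0 ≤ ν ≤ k`; for `k < 0` the sum is empty, as it should be,
since then no coefficient survives. -/
lemma exists_nf_eq_sum_mul_dt_pow {d k : ℤ} {a : (Fin (n + 1) →₀ ℕ) →₀ O n}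
    (ha : ∀ β, TFree (a β)) (hF : ∀ β, a β ≠ 0 → (β.degree : ℤ) ≤ d)
    (hV : ∀ β, a β ≠ 0 → (β (Fin.last n) : ℤ) ≤ k) :
    ∃ P : Fin (k + 1).toNat → Dx n, (∀ ν, P ν ∈ FDx n (d - ν.val)) ∧
      nf a = ∑ ν, incl n (P ν) * dt n ^ ν.val := by
  rw [nf_apply, Finsupp.sum]
  -- Sums of the required shape are closed under addition, so a single term `a_β ∂^β` suffices.
  let S : AddSubmonoid (Dxt n) :=
    { carrier := {w | ∃ P : Fin (k + 1).toNat → Dx n,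
        (∀ ν, P ν ∈ FDx n (d - ν.val)) ∧ w = ∑ ν, incl n (P ν) * dt n ^ ν.val}
      add_mem' := by
        rintro _ _ ⟨P, hP, rfl⟩ ⟨P', hP', rfl⟩
        refine ⟨P + P', fun ν => Submodule.add_mem _ (hP ν) (hP' ν), ?_⟩
        simp only [Pi.add_apply, map_add, add_mul, Finset.sum_add_distrib]
      zero_mem' := ⟨0, fun ν => Submodule.zero_mem _, by simp⟩ }
  suffices h : ∀ β ∈ a.support, germ (a β) * dpow β ∈ S from AddSubmonoid.sum_mem S h
  intro β hβ
  rw [Finsupp.mem_support_iff] at hβ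
  have hk := hV β hβ
  obtain ⟨P, hP, hPe⟩ := exists_germ_mul_dpow_eq (ha β) (hF β hβ)
  have hlt : β (Fin.last n) < (k + 1).toNat := by omega
  refine ⟨Pi.single ⟨β (Fin.last n), hlt⟩ P, fun ν => ?_, ?_⟩
  · by_cases h : ν = ⟨β (Fin.last n), hlt⟩
    · subst h
      rwa [Pi.single_eq_same]
    · rw [Pi.single_eq_of_ne h]
      exact Submodule.zero_mem _
  · rw [Finset.sum_eq_single ⟨β (Fin.last n), hlt⟩]
    · rw [Pi.single_eq_same]
      exact hPe
    · intro ν _ hν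
      rw [Pi.single_eq_of_ne hν, map_zero, zero_mul]
    · exact fun h => absurd (Finset.mem_univ _) h

/-- Each coefficient is split at `t = 0`. In the `t`-free part `μ = 0`, so the `V`-bound becomes `ν
≤ k`; dividing the rest by `t` costs one step of `V` and does not raise the order. -/
lemma exists_eq_sum_mul_dt_pow_add {d k : ℤ} {w : Dxt n} (hw : w ∈ FVD n d k) :
    ∃ (P : Fin (k + 1).toNat → Dx n) (Q : Dxt n), (∀ ν, P ν ∈ FDx n (d - ν.val)) ∧
      Q ∈ FVD n d (k + 1) ∧ w = ∑ ν, incl n (P ν) * dt n ^ ν.val + t n * Q := by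
  obtain ⟨a, rfl⟩ := nf_surjective w
  have hF := nf_mem_FD_iff.1 hw.1
  have hV := nf_mem_VD_iff.1 hw.2
  have ha : nf a = nf (Finsupp.mapRange.linearMap tconst a) +
      t n * nf (Finsupp.mapRange.linearMap tquot a) := by
    rw [t_mul_nf, ← map_add]
    congr 1
    ext β : 1
    exact (tconst_add_t_mul_tquot (a β)).symm
  obtain ⟨P, hP, hPe⟩ := exists_nf_eq_sum_mul_dt_pow (k := k) (d := d)
    (a := Finsupp.mapRange.linearMap tconst a) (fun β => tFree_tconst (a β))
    (fun β hβ => hF β fun h => hβ (by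
      change tconst (a β) = 0
      rw [h, map_zero]))
    (fun β hβ => by
      change tconst (a β) ≠ 0 at hβ
      obtain ⟨α, hα⟩ : ∃ α, MvPowerSeries.coeff α (ser (tconst (a β))) ≠ 0 := by
        by_contra! h
        exact hβ (ser_injective (by ext α; rw [h, map_zero, map_zero]))
      have hα0 := tFree_tconst _ α hα
      rw [coeff_tconst, if_pos hα0] at hα
      have hk := hV β α hα
      rw [hα0] at hk
      simpa using hk)
  refine ⟨P, _, hP, ⟨nf_mem_FD_iff.2 fun β hβ => hF β fun h => hβ ?_,
    nf_mem_VD_iff.2 fun β α hα => ?_⟩, hPe ▸ ha⟩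
  · change tquot (a β) = 0
    rw [h, map_zero]
  · have := hV β _ hα
    rw [Finsupp.add_apply, Finsupp.single_eq_same] at this
    push_cast at this
    omega

end Splitting

/-! ### Comparison of `V_k(M) / t V_{k+1}(M)` with `M / tM` -/

section VFiltration

variable {n : ℕ} {M : Type*} [AddCommGroup M] [Module (Dxt n) M]

lemma dt_mul_t : dt n * t n = t n * dt n + 1 := by
  have h : pdv (Fin.last n) (tO n) = 1 := pdv_last_tO
  rw [dt, t, del_mul_germ, h, germ_one, add_comm]

variable (n) in
/-- An increasing family of `ℂ`-subspaces of `M` such that `t` lowers the index by one, and `∂_t`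
raises it by one. -/
structure IsVFamily (U : ℤ → AddSubgroup M) : Prop where
  mono : ∀ k, U k ≤ U (k + 1)
  algebraMap_smul : ∀ k (c : ℂ), ∀ x ∈ U k, algebraMap ℂ (Dxt n) c • x ∈ U k
  t_smul : ∀ k, ∀ x ∈ U (k + 1), t n • x ∈ U k
  dt_smul : ∀ k, ∀ x ∈ U k, dt n • x ∈ U (k + 1)

/-! ### Polynomials in `t∂_t` acting on a V-family -/

namespace IsVFamily

variable {U : ℤ → AddSubgroup M} (hU : IsVFamily n U)

include hU

lemma monotone : Monotone U := monotone_int_of_le_succ hU.mono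

lemma aeval_smul {k : ℤ} (j : ℤ) (q : Polynomial ℂ) {x : M} (hx : x ∈ U k) :
    Polynomial.aeval (t n * dt n + (j : Dxt n)) q • x ∈ U k := by
  induction q using Polynomial.induction_on' with
  | add p q hp hq => rw [map_add, add_smul]; exact add_mem hp hq
  | monomial m c =>
    rw [Polynomial.aeval_monomial, mul_smul]
    refine hU.algebraMap_smul k c _ ?_
    induction m with
    | zero => simpa using hx
    | succ m ih =>
      rw [pow_succ', mul_smul, add_smul, mul_smul, Int.cast_smul_eq_zsmul]
      exact add_mem (hU.t_smul k _ (hU.dt_smul k _ ih)) (zsmul_mem ih j)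

end IsVFamily

/-- Division of `b` by `X - c` isolates the scalar `b(c)`, which is invertible in the applications.
-/
lemma exists_aeval_eq (A : Dxt n) (c : ℂ) (b : Polynomial ℂ) : ∃ q : Polynomial ℂ,
    Polynomial.aeval A b =
      algebraMap ℂ (Dxt n) (b.eval c) + (A - algebraMap ℂ (Dxt n) c) * Polynomial.aeval A q := by
  obtain ⟨q, hq⟩ := Polynomial.X_sub_C_dvd_sub_C_eval (a := c) (p := b)
  refine ⟨q, ?_⟩
  have h := congrArg (Polynomial.aeval A) hq
  simp only [map_sub, map_mul, Polynomial.aeval_X, Polynomial.aeval_C] at h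
  rw [← h]
  abel

lemma algebraMap_inv_smul {c : ℂ} (hc : c ≠ 0) (x : M) :
    algebraMap ℂ (Dxt n) c⁻¹ • algebraMap ℂ (Dxt n) c • x = x := by
  rw [← mul_smul, ← map_mul, inv_mul_cancel₀ hc, map_one, one_smul]

lemma commute_algebraMap_smul (P : Dxt n) (c : ℂ) (x : M) :
    algebraMap ℂ (Dxt n) c • P • x = P • algebraMap ℂ (Dxt n) c • x := by
  rw [← mul_smul, ← mul_smul, Algebra.commutes]

/-! ### Descent by means of the polynomial `b` -/

namespace IsVFamily

variable {U : ℤ → AddSubgroup M} (hU : IsVFamily n U)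
  {b : Polynomial ℂ} {k₁ : ℤ} (hk₁ : ∀ k : ℤ, k₁ < k → b.eval (k : ℂ) ≠ 0)
  (hb : ∀ k : ℤ, k₁ < k → ∀ x ∈ U k,
    Polynomial.aeval (t n * dt n + (k : Dxt n)) b • x ∈ U (k - 1))

include hU hk₁ hb

/-- With `A = t∂_t + k` one has `A - k = t∂_t`, so `b(k) x = b(A) x - t ∂_t q(A) x`; divide by
`b(k)`. Since `A` preserves every V-family, the two pieces are also controlled in the auxiliary
family `W`. -/
lemma mem_of_smul_eq_add {W : ℤ → AddSubgroup M} (hW : IsVFamily n W) {l k : ℤ} (hk : k₁ < k)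
    {x : M} (hxU : x ∈ U k) (hxW : x ∈ W l) :
    ∃ y ∈ U (k - 1), y ∈ W l ∧ ∃ z ∈ W (l + 1), x = y + t n • z := by
  obtain ⟨q, hq⟩ := exists_aeval_eq (t n * dt n + (k : Dxt n)) (k : ℂ) b
  have hc := hk₁ k hk
  rw [map_intCast, add_sub_cancel_right] at hq
  have h1 := congrArg (· • x) hq
  simp only [add_smul, mul_smul] at h1
  refine ⟨algebraMap ℂ (Dxt n) (b.eval (k : ℂ))⁻¹ •
      Polynomial.aeval (t n * dt n + (k : Dxt n)) b • x,
    hU.algebraMap_smul _ _ _ (hb k hk x hxU), hW.algebraMap_smul _ _ _ (hW.aeval_smul k b hxW),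
    -(algebraMap ℂ (Dxt n) (b.eval (k : ℂ))⁻¹ • dt n •
      Polynomial.aeval (t n * dt n + (k : Dxt n)) q • x),
    neg_mem (hW.algebraMap_smul _ _ _ (hW.dt_smul _ _ (hW.aeval_smul k q hxW))), ?_⟩
  rw [h1, smul_add, algebraMap_inv_smul hc, smul_neg, commute_algebraMap_smul (t n)]
  abel

/-- The index in `U` goes down one step at a time while the index `l` in `W` stays fixed, so all the
multiples of `t` split off come from the one subgroup `W (l + 1)`. -/
lemma exists_eq_add_t_smul {W : ℤ → AddSubgroup M} (hW : IsVFamily n W) {l k : ℤ} (hk : k₁ ≤ k)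
    {x : M} (hxU : x ∈ U k) (hxW : x ∈ W l) :
    ∃ y ∈ U k₁, ∃ z ∈ W (l + 1), x = y + t n • z := by
  induction k, hk using Int.leInduction generalizing x with
  | base => exact ⟨x, hxU, 0, zero_mem _, by simp⟩
  | succ k hk ih =>
    obtain ⟨y, hyU, hyW, z, hz, rfl⟩ := hU.mem_of_smul_eq_add hk₁ hb hW (by omega) hxU hxW
    rw [add_sub_cancel_right] at hyU
    obtain ⟨y', hy', z', hz', rfl⟩ := ih hyU hyW
    exact ⟨y', hy', z' + z, add_mem hz' hz, by rw [smul_add, add_assoc]⟩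

/-- Injectivity of `t` on graded pieces above `k₁`: `b(t∂_t + k + 1) x = b(k) x + q(t∂_t + k + 1)
∂_t t x`, where the left side and the last term lie in `U k`, hence so does `x`. -/
lemma mem_of_t_smul_mem {k : ℤ} (hk : k₁ + 1 ≤ k) {x : M} (hx : x ∈ U k)
    (htx : t n • x ∈ U k₁) : x ∈ U (k₁ + 1) := by
  induction k, hk using Int.leInduction with
  | base => exact hx
  | succ k hk ih =>
    apply ih
    -- The polynomial is expanded at `k`, not at `k + 1`: subtracting `k` from `t∂_t + k + 1` leaves
    -- `t∂_t + 1 = ∂_t t`.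
    obtain ⟨q, hq⟩ := exists_aeval_eq (t n * dt n + ((k + 1 : ℤ) : Dxt n)) (k : ℂ) b
    rw [map_intCast, show t n * dt n + ((k + 1 : ℤ) : Dxt n) - (k : Dxt n) = dt n * t n by
      rw [dt_mul_t]; push_cast; abel] at hq
    -- Both are polynomials in `t∂_t + k + 1`. The factor `∂_t t` is moved to the right so that it
    -- meets `x` first, where the hypothesis on `t x` applies.
    have hcomm : Commute (dt n * t n)
        (Polynomial.aeval (t n * dt n + ((k + 1 : ℤ) : Dxt n)) q) := by
      have h2 : dt n * t n = Polynomial.aeval (t n * dt n + ((k + 1 : ℤ) : Dxt n))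
          (Polynomial.X - Polynomial.C (k : ℂ)) := by
        simp only [map_sub, Polynomial.aeval_X, map_intCast]
        rw [dt_mul_t]
        push_cast
        abel
      rw [h2, Commute, SemiconjBy, ← map_mul, mul_comm, map_mul]
    rw [hcomm.eq] at hq
    have h1 := congrArg (· • x) hq
    simp only [add_smul, mul_smul] at h1
    have h3 := hb (k + 1) (by omega) x hx
    rw [add_sub_cancel_right, h1] at h3
    have h4 : dt n • t n • x ∈ U k :=
      hU.monotone (by omega : k₁ + 1 ≤ k) (hU.dt_smul _ _ htx)
    have h5 := (add_mem_cancel_right (hU.aeval_smul (k + 1) q h4)).1 h3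
    have h6 := hU.algebraMap_smul _ (b.eval (k : ℂ))⁻¹ _ h5
    rwa [algebraMap_inv_smul (hk₁ k (by omega))] at h6

end IsVFamily

/-! ### The filtration generated by `V_0` in positive degrees -/

namespace Bifiltration

variable (B : Bifiltration n M)

lemma smul_mem_V {d k l : ℤ} {P : Dxt n} (hP : P ∈ FVD n d k) {x : M} (hx : x ∈ B.V l) :
    P • x ∈ B.V (k + l) := by
  obtain ⟨e, hx⟩ := hx
  exact ⟨_, B.smul_mem hP hx⟩

lemma isVFamily_V : IsVFamily n fun k => (B.V k).toAddSubgroup where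
  mono k x := fun ⟨d, hx⟩ => ⟨d, B.mono_right d k hx⟩
  algebraMap_smul k c x hx := (B.V k).smul_mem (algebraMap ℂ (Dx n) c) hx
  t_smul k x hx := by
    have h := B.smul_mem_V (t_mem_FVD n) hx
    rwa [neg_add_cancel_comm_assoc] at h
  dt_smul k x hx := by
    have h := B.smul_mem_V (d := 1) (k := 1) (P := dt n)
      ⟨del_mem_FD _, (if_pos rfl : (if Fin.last n = Fin.last n then (1 : ℤ) else 0) = 1) ▸
        del_mem_VD (Fin.last n)⟩ hx
    rwa [add_comm] at h

/-- The subspaces `V_0(M) + ∂_t V_0(M) + ⋯ + ∂_t^k V_0(M)`. -/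
def tower : ℕ → AddSubgroup M
  | 0 => (B.V 0).toAddSubgroup
  | k + 1 => tower k ⊔ (tower k).map (DistribSMul.toAddMonoidHom M (dt n))

lemma mem_tower_succ {k : ℕ} {x : M} : x ∈ B.tower (k + 1) ↔
    ∃ y ∈ B.tower k, ∃ z ∈ B.tower k, y + dt n • z = x := by
  rw [tower, AddSubgroup.mem_sup]
  simp

lemma tower_mono (k : ℕ) : B.tower k ≤ B.tower (k + 1) := le_sup_left

lemma dt_smul_mem_tower {k : ℕ} {x : M} (hx : x ∈ B.tower k) : dt n • x ∈ B.tower (k + 1) :=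
  B.mem_tower_succ.2 ⟨0, zero_mem _, x, hx, zero_add _⟩

/-- Commuting a function past `∂_t` costs only a term without that `∂_t`. -/
lemma germ_smul_mem_tower {k : ℕ} (a : O n) {x : M} (hx : x ∈ B.tower k) :
    germ a • x ∈ B.tower k := by
  induction k generalizing x a with
  | zero =>
    exact B.smul_mem_V (d := 0) (k := 0) (l := 0)
      ⟨germ_mem_FD a, germ_mem_VD a fun α _ => by simp⟩ hx
  | succ k ih =>
    obtain ⟨y, hy, z, hz, rfl⟩ := B.mem_tower_succ.1 hx
    have h : germ a * dt n = dt n * germ a - germ (pdv (Fin.last n) a) := by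
      rw [dt, del_mul_germ]
      abel
    rw [smul_add, ← mul_smul, h, sub_smul, mul_smul]
    exact add_mem (B.tower_mono k (ih a hy)) (sub_mem (B.dt_smul_mem_tower (ih a hz))
      (B.tower_mono k (ih _ hz)))

lemma del_castSucc_smul_mem_tower {k : ℕ} (i : Fin n) {x : M} (hx : x ∈ B.tower k) :
    del i.castSucc • x ∈ B.tower k := by
  induction k generalizing x with
  | zero =>
    exact B.smul_mem_V (d := 1) (k := 0) (l := 0)
      ⟨del_mem_FD _, by simpa [(Fin.castSucc_lt_last i).ne] using del_mem_VD i.castSucc⟩ hx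
  | succ k ih =>
    obtain ⟨y, hy, z, hz, rfl⟩ := B.mem_tower_succ.1 hx
    rw [smul_add, ← mul_smul, dt, (del_comm i.castSucc (Fin.last n)).eq, mul_smul]
    exact add_mem (B.tower_mono k (ih hy)) (B.dt_smul_mem_tower (ih hz))

lemma algebraMap_eq_germ (c : ℂ) : algebraMap ℂ (Dxt n) c = germ (c • 1) := by
  rw [germ_smul, germ_one, Algebra.algebraMap_eq_smul_one]

/-- Functions and the `∂_{x_i}` preserve each level and `∂_t` raises it by one, so the union of the
levels is a `𝒟_{x,t}`-submodule. -/
lemma exists_smul_mem_tower (P : Dxt n) {k : ℕ} {x : M} (hx : x ∈ B.tower k) :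
    ∃ l, P • x ∈ B.tower l := by
  have hmono : Monotone B.tower := monotone_nat_of_le_succ B.tower_mono
  -- The order is irrelevant here; this only presents `P` as a combination of operators `a ∂^β`.
  obtain ⟨d, -, hP, -⟩ := exists_FVD P
  induction hP using Submodule.span_induction with
  | mem P h =>
    obtain ⟨a, w, -, rfl⟩ := h
    suffices ∃ l, (w.map del).prod • x ∈ B.tower l by
      obtain ⟨l, hl⟩ := this
      exact ⟨l, by rw [mono, mul_smul]; exact B.germ_smul_mem_tower a hl⟩
    induction w with
    | nil => exact ⟨k, by simpa using hx⟩
    | cons i w ih =>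
      obtain ⟨l, hl⟩ := ih
      refine ⟨l + 1, ?_⟩
      rw [List.map_cons, List.prod_cons, mul_smul]
      induction i using Fin.lastCases with
      | last => exact B.dt_smul_mem_tower hl
      | cast i => exact B.tower_mono l (B.del_castSucc_smul_mem_tower i hl)
  | zero => exact ⟨0, by rw [zero_smul]; exact zero_mem _⟩
  | add P Q _ _ hP hQ =>
    obtain ⟨l, hl⟩ := hP
    obtain ⟨m, hm⟩ := hQ
    exact ⟨max l m, by
      rw [add_smul]
      exact add_mem (hmono (le_max_left _ _) hl) (hmono (le_max_right _ _) hm)⟩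
  | smul c P _ hP =>
    obtain ⟨l, hl⟩ := hP
    exact ⟨l, by
      rw [Algebra.smul_def, mul_smul, algebraMap_eq_germ]
      exact B.germ_smul_mem_tower _ hl⟩

lemma exists_mem_tower (hgen : Submodule.span (Dxt n) (B.V 0 : Set M) = ⊤) (x : M) :
    ∃ k, x ∈ B.tower k := by
  have hmono : Monotone B.tower := monotone_nat_of_le_succ B.tower_mono
  have hx : x ∈ Submodule.span (Dxt n) (B.V 0 : Set M) := hgen ▸ Submodule.mem_top
  induction hx using Submodule.span_induction with
  | mem x h => exact ⟨0, h⟩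
  | zero => exact ⟨0, zero_mem _⟩
  | add x y _ _ hx hy =>
    obtain ⟨l, hl⟩ := hx
    obtain ⟨m, hm⟩ := hy
    exact ⟨max l m, add_mem (hmono (le_max_left _ _) hl) (hmono (le_max_right _ _) hm)⟩
  | smul P x _ hx =>
    obtain ⟨l, hl⟩ := hx
    exact B.exists_smul_mem_tower P hl

lemma tower_le_V (k : ℕ) : B.tower k ≤ (B.V (k : ℤ)).toAddSubgroup := by
  induction k with
  | zero => exact le_rfl
  | succ k ih =>
    intro x hx
    obtain ⟨y, hy, z, hz, rfl⟩ := B.mem_tower_succ.1 hx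
    exact add_mem (B.isVFamily_V.mono _ (ih hy)) (B.isVFamily_V.dt_smul _ _ (ih hz))

/-- At level `0`, `t∂_t` preserves `V_0`; higher up, `t∂_t² = ∂_t(t∂_t) - ∂_t`. -/
lemma t_smul_dt_smul_mem_tower {k : ℕ} {x : M} (hx : x ∈ B.tower k) :
    t n • dt n • x ∈ B.tower k := by
  induction k generalizing x with
  | zero => exact B.isVFamily_V.t_smul 0 _ (B.isVFamily_V.dt_smul 0 _ hx)
  | succ k ih =>
    obtain ⟨y, hy, z, hz, rfl⟩ := B.mem_tower_succ.1 hx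
    rw [smul_add, smul_add]
    refine add_mem (B.tower_mono k (ih hy)) ?_
    have h : t n * (dt n * dt n) = dt n * (t n * dt n) - dt n := by
      rw [← mul_assoc, ← mul_assoc, dt_mul_t, add_mul, one_mul, add_sub_cancel_right]
    rw [← mul_smul, ← mul_smul, mul_assoc, h, sub_smul, mul_smul, mul_smul]
    exact sub_mem (B.dt_smul_mem_tower (ih hz)) (B.dt_smul_mem_tower hz)

lemma t_smul_mem_tower {k : ℕ} {x : M} (hx : x ∈ B.tower (k + 1)) : t n • x ∈ B.tower k := by
  obtain ⟨y, hy, z, hz, rfl⟩ := B.mem_tower_succ.1 hx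
  rw [smul_add]
  exact add_mem (B.germ_smul_mem_tower _ hy) (B.t_smul_dt_smul_mem_tower hz)

/-- The filtration which is `V_k(M)` for `k ≤ 0`, and `∑_{j ≤ k} ∂_t^j V_0(M)` for `k ≥ 0`. -/
def VGen (k : ℤ) : AddSubgroup M := if k ≤ 0 then (B.V k).toAddSubgroup else B.tower k.toNat

lemma VGen_of_nonpos {k : ℤ} (h : k ≤ 0) : B.VGen k = (B.V k).toAddSubgroup := if_pos h

lemma VGen_natCast (k : ℕ) : B.VGen (k : ℤ) = B.tower k := by
  rw [VGen]
  split_ifs with h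
  · obtain rfl : k = 0 := by omega
    rfl
  · rfl

lemma VGen_le_V (k : ℤ) : B.VGen k ≤ (B.V k).toAddSubgroup := by
  rcases le_or_gt k 0 with h | h
  · rw [B.VGen_of_nonpos h]
  · lift k to ℕ using h.le
    rw [VGen_natCast]
    exact B.tower_le_V k

lemma isVFamily_VGen : IsVFamily n B.VGen := by
  -- The two descriptions agree at `0`, so each pair `k`, `k + 1` is covered by just one of them.
  have key : ∀ k : ℤ, (k ≤ 0 ∧ k + 1 ≤ 0) ∨ ∃ l : ℕ, k = l := fun k => by
    rcases lt_or_ge k 0 with h | h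
    · exact Or.inl ⟨h.le, h⟩
    · exact Or.inr ⟨k.toNat, by omega⟩
  constructor
  · intro k
    rcases key k with ⟨h, h'⟩ | ⟨l, rfl⟩
    · rw [B.VGen_of_nonpos h, B.VGen_of_nonpos h']
      exact B.isVFamily_V.mono k
    · rw [← Nat.cast_succ, VGen_natCast, VGen_natCast]
      exact B.tower_mono l
  · intro k c x hx
    rcases key k with ⟨h, h'⟩ | ⟨l, rfl⟩
    · rw [B.VGen_of_nonpos h] at hx ⊢
      exact B.isVFamily_V.algebraMap_smul k c x hx
    · rw [VGen_natCast] at hx ⊢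
      rw [algebraMap_eq_germ]
      exact B.germ_smul_mem_tower _ hx
  · intro k x hx
    rcases key k with ⟨h, h'⟩ | ⟨l, rfl⟩
    · rw [B.VGen_of_nonpos h'] at hx
      rw [B.VGen_of_nonpos h]
      exact B.isVFamily_V.t_smul k x hx
    · rw [← Nat.cast_succ, VGen_natCast] at hx
      rw [VGen_natCast]
      exact B.t_smul_mem_tower hx
  · intro k x hx
    rcases key k with ⟨h, h'⟩ | ⟨l, rfl⟩
    · rw [B.VGen_of_nonpos h] at hx
      rw [B.VGen_of_nonpos h']
      exact B.isVFamily_V.dt_smul k x hx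
    · rw [VGen_natCast] at hx
      rw [← Nat.cast_succ, VGen_natCast]
      exact B.dt_smul_mem_tower hx

/-- Everything follows from `(t∂_t + k + 1)∂_t = ∂_t(t∂_t + k)`. -/
lemma aeval_mul_dt (b : Polynomial ℂ) (k : ℤ) :
    Polynomial.aeval (t n * dt n + ((k + 1 : ℤ) : Dxt n)) b * dt n =
      dt n * Polynomial.aeval (t n * dt n + (k : Dxt n)) b := by
  have h1 : (t n * dt n + ((k + 1 : ℤ) : Dxt n)) * dt n =
      dt n * (t n * dt n + (k : Dxt n)) := by
    rw [mul_add, ← mul_assoc, dt_mul_t, ← (Int.cast_commute k (dt n)).eq]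
    push_cast
    noncomm_ring
  induction b using Polynomial.induction_on' with
  | add p q hp hq => rw [map_add, map_add, add_mul, mul_add, hp, hq]
  | monomial m c =>
    rw [Polynomial.aeval_monomial, Polynomial.aeval_monomial, mul_assoc, ← mul_assoc (dt n),
      ← Algebra.commutes, mul_assoc]
    congr 1
    induction m with
    | zero => simp
    | succ m ih => rw [pow_succ', mul_assoc, ih, ← mul_assoc, h1, mul_assoc, ← pow_succ']

/-- For `x = y + ∂_t z` at level `k + 1`, the part `y` has index `k` already, and on `∂_t z` the
operator passes through `∂_t`, with `k + 1` becoming `k`. Hence the hypothesis at `0` propagates to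
all positive degrees. -/
lemma aeval_smul_mem_VGen {b : Polynomial ℂ}
    (hb_zero : ∀ x ∈ B.V 0, Polynomial.aeval (t n * dt n) b • x ∈ B.V (-1))
    (k : ℕ) {x : M} (hx : x ∈ B.VGen (k : ℤ)) :
    Polynomial.aeval (t n * dt n + ((k : ℤ) : Dxt n)) b • x ∈ B.VGen ((k : ℤ) - 1) := by
  induction k generalizing x with
  | zero =>
    rw [VGen_natCast] at hx
    rw [B.VGen_of_nonpos (by simp)]
    simpa using hb_zero x hx
  | succ k ih =>
    rw [VGen_natCast] at hx
    obtain ⟨y, hy, z, hz, rfl⟩ := B.mem_tower_succ.1 hx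
    rw [← VGen_natCast] at hy hz
    rw [Nat.cast_succ, add_sub_cancel_right, smul_add, ← mul_smul _ (dt n), aeval_mul_dt,
      mul_smul]
    have h := B.isVFamily_VGen.dt_smul _ _ (ih hz)
    rw [sub_add_cancel] at h
    exact add_mem (B.isVFamily_VGen.aeval_smul _ b hy) h

variable {b : Polynomial ℂ} {k₁ : ℤ}
  (hgen : Submodule.span (Dxt n) (B.V 0 : Set M) = ⊤)
  (hb_zero : ∀ x ∈ B.V 0, Polynomial.aeval (t n * dt n) b • x ∈ B.V (-1))
  (hk₁ : ∀ k : ℤ, k₁ < k → b.eval (k : ℂ) ≠ 0)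
  (hb_neg : ∀ k : ℤ, k₁ < k → k < 0 →
    ∀ x ∈ B.V k, Polynomial.aeval (t n * dt n + (k : Dxt n)) b • x ∈ B.V (k - 1))

include hb_zero hb_neg in
lemma aeval_smul_mem_VGen_of_lt (k : ℤ) (hk : k₁ < k) (x : M) (hx : x ∈ B.VGen k) :
    Polynomial.aeval (t n * dt n + (k : Dxt n)) b • x ∈ B.VGen (k - 1) := by
  rcases lt_or_ge k 0 with h | h
  · rw [B.VGen_of_nonpos h.le] at hx
    rw [B.VGen_of_nonpos (by omega)]
    exact hb_neg k hk h x hx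
  · lift k to ℕ using h
    exact B.aeval_smul_mem_VGen hb_zero k hx

include hgen in
lemma exists_mem_VGen (k : ℤ) (x : M) : ∃ l, k ≤ l ∧ x ∈ B.VGen l := by
  obtain ⟨m, hm⟩ := B.exists_mem_tower hgen x
  rw [← VGen_natCast] at hm
  exact ⟨max k m, le_max_left _ _, B.isVFamily_VGen.monotone (le_max_right _ _) hm⟩

include hgen hb_zero hk₁ hb_neg

lemma exists_mem_V_eq_add_t_smul (x : M) : ∃ y ∈ B.V k₁, ∃ z, x = y + t n • z := by
  obtain ⟨k, hk, hx⟩ := B.exists_mem_VGen hgen k₁ x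
  obtain ⟨y, hy, z, -, h⟩ := B.isVFamily_VGen.exists_eq_add_t_smul hk₁
    (B.aeval_smul_mem_VGen_of_lt hb_zero hb_neg) B.isVFamily_VGen hk hx hx
  exact ⟨y, B.VGen_le_V _ hy, z, h⟩

/-- For `k₁ > 0`, `tx` is only known to lie in `V_{k₁}`, not in `VGen k₁`. So `tx = y + tz` is split
off with `y ∈ VGen k₁` and, taking `V` as auxiliary family, `z ∈ V_{k₁+1}`. Then `t(x - z) = y`, and
injectivity on graded pieces puts `x - z` in `VGen (k₁ + 1)`. -/
lemma exists_mem_V_of_t_smul_mem {x : M} (hx : t n • x ∈ B.V k₁) :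
    ∃ y ∈ B.V (k₁ + 1), t n • y = t n • x := by
  obtain ⟨k, hk, hxk⟩ := B.exists_mem_VGen hgen k₁ (t n • x)
  obtain ⟨y, hy, z, hz, h⟩ := B.isVFamily_VGen.exists_eq_add_t_smul hk₁
    (B.aeval_smul_mem_VGen_of_lt hb_zero hb_neg) B.isVFamily_V hk hxk hx
  have hy' : y = t n • (x - z) := by rw [smul_sub, h, add_sub_cancel_right]
  obtain ⟨l, hl, hxz⟩ := B.exists_mem_VGen hgen (k₁ + 1) (x - z)
  have h1 := B.isVFamily_VGen.mem_of_t_smul_mem hk₁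
    (B.aeval_smul_mem_VGen_of_lt hb_zero hb_neg) hl hxz (hy' ▸ hy)
  refine ⟨x - z + z, add_mem (B.VGen_le_V _ h1) hz, by rw [sub_add_cancel]⟩

end Bifiltration

end VFiltration

/-! ### The free modules `V_k(L) / t V_{k+1}(L)` -/

namespace Bifiltration

variable {n : ℕ} {M : Type*} [AddCommGroup M] [Module (Dxt n) M] (B : Bifiltration n M)

lemma mem_filVQ_iff {d k : ℤ} {z : B.VQ k} :
    z ∈ (B.filVQ k).F d ↔ ∃ (x : M) (hx : x ∈ B.F d k), B.cls hx = z := by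
  constructor
  · rintro ⟨x, hx, rfl⟩
    exact ⟨x, hx, rfl⟩
  · rintro ⟨x, hx, rfl⟩
    exact B.cls_mem hx

lemma exists_mem_filVQ {k : ℤ} (z : B.VQ k) : ∃ d, z ∈ (B.filVQ k).F d := by
  obtain ⟨⟨x, d, hx⟩, rfl⟩ := Submodule.Quotient.mk_surjective _ z
  exact ⟨d, B.cls_mem hx⟩

lemma cls_eq_iff {d d' k : ℤ} {x y : M} (hx : x ∈ B.F d k) (hy : y ∈ B.F d' k) :
    B.cls hx = B.cls hy ↔ x - y ∈ B.tV k := Submodule.Quotient.eq _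

lemma cls_eq_zero_iff {d k : ℤ} {x : M} (hx : x ∈ B.F d k) :
    B.cls hx = 0 ↔ x ∈ B.tV k := Submodule.Quotient.mk_eq_zero _

end Bifiltration

section Free

variable {n r : ℕ} {sF sV : Fin r → ℤ}

/-- If `x = t y` with `y ∈ V_{k+1}`, the same `y` works: its `V`-bound is given and its order bound
is that of `t y`. -/
lemma free_F_inf_tV (d k : ℤ) : (free n sF sV).F d k ⊓ ((free n sF sV).tV k).toAddSubgroup =
    ((free n sF sV).F d (k + 1)).map (tmul n (Fin r → Dxt n)).toAddMonoidHom := by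
  ext x
  constructor
  · rintro ⟨hx, y, ⟨e, hy⟩, rfl⟩
    exact ⟨y, fun i => ⟨mem_FD_of_t_mul_mem (hx i).1, (hy i).2⟩, rfl⟩
  · rintro ⟨y, hy, rfl⟩
    exact ⟨(free n sF sV).t_smul_mem hy, y, ⟨d, hy⟩, rfl⟩

lemma free_t_smul_eq_zero {y : Fin r → Dxt n} (h : t n • y = 0) : y = 0 :=
  funext fun i => t_mul_injective ((congrFun h i).trans (mul_zero (t n)).symm)

lemma dt_pow_mem (j : ℕ) : dt n ^ j ∈ FVD n j j := by
  induction j with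
  | zero => exact ⟨by simpa using one_mem_FD n, by simpa using one_mem_VD n⟩
  | succ j ih =>
    have h : dt n ∈ FVD n 1 1 := ⟨del_mem_FD _,
      (if_pos rfl : (if Fin.last n = Fin.last n then (1 : ℤ) else 0) = 1) ▸
        del_mem_VD (Fin.last n)⟩
    rw [pow_succ]
    push_cast
    exact mul_mem_FVD ih h

/-- The index set of the basis `∂_t^ν e_i`, `0 ≤ ν ≤ k - m_i`, of `V_k(L) / t V_{k+1}(L)`. -/
abbrev FreeIndex (sV : Fin r → ℤ) (k : ℤ) : Type := Σ i, Fin (k - sV i + 1).toNat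

variable (n) in
/-- The map `(P_{i,ν}) ↦ ∑ P_{i,ν} ∂_t^ν e_i`. -/
def dtComb (sV : Fin r → ℤ) (k : ℤ) :
    (FreeIndex sV k → Dx n) →ₗ[Dx n] (Fin r → Dxt n) where
  toFun P i := ∑ ν, incl n (P ⟨i, ν⟩) * dt n ^ ν.val
  map_add' P Q := by
    ext i : 1
    simp only [Pi.add_apply, map_add, add_mul, Finset.sum_add_distrib]
  map_smul' c P := by
    ext i : 1
    change _ = incl n c * ∑ ν, incl n (P ⟨i, ν⟩) * dt n ^ ν.val
    rw [Finset.mul_sum]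
    refine Finset.sum_congr rfl fun ν _ => ?_
    rw [Pi.smul_apply, smul_eq_mul, map_mul, mul_assoc]

lemma dtComb_apply (k : ℤ) (P : FreeIndex sV k → Dx n) (i : Fin r) :
    dtComb n sV k P i = ∑ ν, incl n (P ⟨i, ν⟩) * dt n ^ ν.val := rfl

lemma dtComb_mem_F {d k : ℤ} {P : FreeIndex sV k → Dx n}
    (hP : ∀ p, P p ∈ FDx n (d - (sF p.1 + p.2.val))) :
    dtComb n sV k P ∈ (free n sF sV).F d k := by
  intro i
  rw [dtComb_apply]
  refine Submodule.sum_mem _ fun ν _ => ?_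
  have h := mul_mem_FVD ⟨hP ⟨i, ν⟩, Dx_le_VD (incl_mem (P ⟨i, ν⟩))⟩ (dt_pow_mem (n := n) ν.val)
  have hν := ν.2
  -- `∂_t^ν` contributes `ν` to both indices: the order bound was lowered by `ν` in advance, and the
  -- range of `ν` gives `ν ≤ k - m_i`.
  exact ⟨FD_mono (by simp only; omega) h.1, VD_mono (by omega) h.2⟩

lemma dtComb_mem_V (k : ℤ) (P : FreeIndex sV k → Dx n) :
    dtComb n sV k P ∈ (free n sF sV).V k := by
  choose d hd using fun p => Dx_exists_FD (incl_mem (P p))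
  obtain ⟨D, hD⟩ := (Set.finite_range fun p : FreeIndex sV k =>
    d p + (sF p.1 + p.2.val)).bddAbove
  refine ⟨D, dtComb_mem_F fun p => FD_mono ?_ (hd p)⟩
  have := hD ⟨p, rfl⟩
  simp only at this
  omega

variable (n) in
/-- The map `(P_{i,ν}) ↦ [∑ P_{i,ν} ∂_t^ν e_i]`. -/
def dtCombQ (sF sV : Fin r → ℤ) (k : ℤ) :
    (FreeIndex sV k → Dx n) →ₗ[Dx n] (free n sF sV).VQ k :=
  (((free n sF sV).tV k).submoduleOf ((free n sF sV).V k)).mkQ ∘ₗ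
    (dtComb n sV k).codRestrict ((free n sF sV).V k) (dtComb_mem_V k)

lemma dtCombQ_eq_cls {d k : ℤ} {P : FreeIndex sV k → Dx n}
    (h : dtComb n sV k P ∈ (free n sF sV).F d k) :
    dtCombQ n sF sV k P = (free n sF sV).cls h := rfl

lemma dtCombQ_injective (k : ℤ) : Function.Injective (dtCombQ n sF sV k) := by
  rw [← LinearMap.ker_eq_bot, LinearMap.ker_eq_bot']
  intro P hP
  obtain ⟨y, -, hy⟩ := (Submodule.Quotient.mk_eq_zero _).1 hP
  ext ⟨i, ν⟩ : 1
  exact congrFun (eq_zero_of_sum_mul_dt_pow_eq (fun ν => P ⟨i, ν⟩) (y i)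
    (congrFun hy i).symm) ν

/-- The order bounds on the `P_{i,ν}` matter as much as their existence: with injectivity they make
the basis a filtered one. -/
lemma exists_dtCombQ_eq {d k : ℤ} {x : Fin r → Dxt n} (hx : x ∈ (free n sF sV).F d k) :
    ∃ P : FreeIndex sV k → Dx n, (∀ p, P p ∈ FDx n (d - (sF p.1 + p.2.val))) ∧
      dtCombQ n sF sV k P = (free n sF sV).cls hx := by
  choose P Q hP hQ h using fun i => exists_eq_sum_mul_dt_pow_add (hx i)
  have hPF : ∀ p : FreeIndex sV k, P p.1 p.2 ∈ FDx n (d - (sF p.1 + p.2.val)) := fun p => by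
    rw [← sub_sub]
    exact hP p.1 p.2
  refine ⟨fun p => P p.1 p.2, hPF, ?_⟩
  rw [dtCombQ_eq_cls (dtComb_mem_F hPF), eq_comm, Bifiltration.cls_eq_iff]
  refine ⟨Q, ⟨d, fun i => ?_⟩, funext fun i => ?_⟩
  · rw [add_sub_right_comm]
    exact hQ i
  · rw [Pi.sub_apply, h i, dtComb_apply, add_sub_cancel_left]
    rfl

lemma isFilteredFree_free_filVQ (k : ℤ) : IsFilteredFree ((free n sF sV).filVQ k) := by
  let e := LinearEquiv.ofBijective (dtCombQ n sF sV k) ⟨dtCombQ_injective k, fun z => by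
    obtain ⟨d, hz⟩ := (free n sF sV).exists_mem_filVQ z
    obtain ⟨x, hx, rfl⟩ := (free n sF sV).mem_filVQ_iff.1 hz
    obtain ⟨P, -, hP⟩ := exists_dtCombQ_eq hx
    exact ⟨P, hP⟩⟩
  have he : ∀ d P, e P ∈ ((free n sF sV).filVQ k).F d ↔
      ∀ p, P p ∈ FDx n (d - (sF p.1 + p.2.val)) := by
    intro d P
    constructor
    · intro h
      obtain ⟨x, hx, hxe⟩ := (free n sF sV).mem_filVQ_iff.1 h
      obtain ⟨P', hP', h'⟩ := exists_dtCombQ_eq hx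
      obtain rfl : P' = P := dtCombQ_injective k (h'.trans hxe)
      exact hP'
    · exact fun h => (free n sF sV).cls_mem (dtComb_mem_F h)
  let f := Fintype.equivFin (FreeIndex sV k)
  refine ⟨_, fun j => sF (f.symm j).1 + (f.symm j).2.val,
    (LinearEquiv.funCongrLeft (Dx n) (Dx n) f).trans e, fun d v => ?_⟩
  rw [LinearEquiv.trans_apply, he]
  constructor
  · intro h j
    have := h (f.symm j)
    rwa [LinearEquiv.funCongrLeft_apply, LinearMap.funLeft_apply, Equiv.apply_symm_apply] at this
  · intro h p
    have := h (f p)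
    beta_reduce at this
    rwa [Equiv.symm_apply_apply] at this

end Free

/-! ### The induced filtered resolution -/

namespace BifilteredFreeResolution

variable {n : ℕ} {M : Type*} [AddCommGroup M] [Module (Dxt n) M] {B : Bifiltration n M}
  (R : BifilteredFreeResolution B)

/-- By assertion 1, `ψ x = t y` with `y ∈ F_{d,k+1}`. The next map kills `t y`, hence `y`, as `t` is
injective on its target; a lift `z` of `y` gives the correction. -/
lemma exists_sub_t_smul_mem_ker {d k : ℤ} (ht : Function.Injective fun x : M => t n • x)
    (i : ℕ) {x : Fin (R.r (i + 1)) → Dxt n} (hx : x ∈ (R.L (i + 1)).F d k)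
    (hψ : R.ψ i x ∈ (R.L i).tV k) :
    ∃ z ∈ (R.L (i + 1)).F d (k + 1), R.ψ i (x - t n • z) = 0 := by
  have h : R.ψ i x ∈ (R.L i).F d k ⊓ ((R.L i).tV k).toAddSubgroup :=
    ⟨R.ψ_bifiltered i d k x hx, hψ⟩
  rw [free_F_inf_tV] at h
  obtain ⟨y, hy, hyx⟩ := h
  replace hyx : t n • y = R.ψ i x := hyx
  obtain ⟨z, hz, hzy⟩ : ∃ z ∈ (R.L (i + 1)).F d (k + 1), R.ψ i z = y := by
    -- The next target is `M` for `i = 0`, where injectivity of `t` is a hypothesis, and a free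
    -- module otherwise.
    cases i with
    | zero =>
      refine R.F_exact_zero _ _ y hy (ht ?_)
      change t n • R.ε y = t n • (0 : M)
      rw [← map_smul, hyx, smul_zero]
      exact R.exact_zero.apply_apply_eq_zero x
    | succ i =>
      refine R.F_exact_succ i _ _ y hy (free_t_smul_eq_zero ?_)
      rw [← map_smul, hyx]
      exact (R.exact_succ i).apply_apply_eq_zero x
  exact ⟨z, hz, by rw [map_sub, map_smul, hzy, hyx, sub_self]⟩

lemma isFilteredFreeResolution {k : ℤ}
    (hV : ∀ x : M, ∃ y ∈ B.V k, ∃ z, x = y + t n • z)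
    (htV : ∀ x : M, t n • x ∈ B.V k → ∃ y ∈ B.V (k + 1), t n • y = t n • x)
    (ht : Function.Injective fun x : M => t n • x)
    (hF : ∀ d : ℤ, B.F d k ⊓ (B.tV k).toAddSubgroup =
      (B.F d (k + 1)).map (tmul n M).toAddMonoidHom) :
    IsFilteredFreeResolution (fun i => (R.L i).filVQ k) (B.filMt k)
      (fun i => mapVQ (R.ψ_bifiltered i) k) (augVQ R.ε_bifiltered k) := by
  have hexh : (B.filMt k).IsExhaustive := fun x => by
    obtain ⟨x, rfl⟩ := Submodule.Quotient.mk_surjective _ x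
    obtain ⟨y, ⟨d, hy⟩, z, rfl⟩ := hV x
    refine ⟨d, y, hy, (Submodule.Quotient.eq _).2 ⟨-z, ?_⟩⟩
    rw [map_neg, sub_add_cancel_left]
    rfl
  have hsurj : ∀ d, ∀ x ∈ (B.filMt k).F d,
      ∃ y ∈ ((R.L 0).filVQ k).F d, augVQ R.ε_bifiltered k y = x := by
    rintro d _ ⟨m, hm, rfl⟩
    obtain ⟨y, hy, rfl⟩ := R.F_surjective d k m hm
    exact ⟨_, (R.L 0).cls_mem hy, rfl⟩
  have hzero : ∀ d, ∀ x ∈ ((R.L 0).filVQ k).F d, augVQ R.ε_bifiltered k x = 0 →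
      ∃ y ∈ ((R.L 1).filVQ k).F d, mapVQ (R.ψ_bifiltered 0) k y = x := by
    intro d z hz hx0
    obtain ⟨x, hx, rfl⟩ := (R.L 0).mem_filVQ_iff.1 hz
    obtain ⟨m, hm⟩ := (Submodule.Quotient.mk_eq_zero _).1 hx0
    replace hm : t n • m = R.ε x := hm
    have hxF := R.ε_bifiltered d k x hx
    -- Two improvements of `ε x = t m`: first `m` is replaced by an element of `V_{k+1}`, which
    -- makes `hF` applicable, then by one of `F_{d,k+1}`, which lifts to `L_0` with control of the
    -- order.
    obtain ⟨y, hy, hym⟩ := htV m ⟨d, hm ▸ hxF⟩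
    have h : R.ε x ∈ B.F d k ⊓ (B.tV k).toAddSubgroup := ⟨hxF, y, hy, hym.trans hm⟩
    rw [hF] at h
    obtain ⟨y', hy', hyx⟩ := h
    replace hyx : t n • y' = R.ε x := hyx
    obtain ⟨z, hz, rfl⟩ := R.F_surjective d (k + 1) y' hy'
    have htz := (R.L 0).t_smul_mem hz
    obtain ⟨w, hw, hwx⟩ := R.F_exact_zero d k (x - t n • z) (sub_mem hx htz)
      (by rw [map_sub, map_smul, hyx, sub_self])
    refine ⟨_, (R.L 1).cls_mem hw, ?_⟩
    refine ((R.L 0).cls_eq_iff (R.ψ_bifiltered 0 d k w hw) hx).2 ?_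
    rw [hwx]
    exact ⟨-z, neg_mem ⟨d, hz⟩, by rw [map_neg, sub_sub_cancel_left]; rfl⟩
  have hsucc : ∀ i d, ∀ x ∈ ((R.L (i + 1)).filVQ k).F d, mapVQ (R.ψ_bifiltered i) k x = 0 →
      ∃ y ∈ ((R.L (i + 2)).filVQ k).F d, mapVQ (R.ψ_bifiltered (i + 1)) k y = x := by
    intro i d z hz hx0
    obtain ⟨x, hx, rfl⟩ := (R.L (i + 1)).mem_filVQ_iff.1 hz
    have hψ : R.ψ i x ∈ (R.L i).tV k := ((R.L i).cls_eq_zero_iff (R.ψ_bifiltered i d k x hx)).1 hx0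
    obtain ⟨z, hz, hzx⟩ := R.exists_sub_t_smul_mem_ker ht i hx hψ
    have htz := (R.L (i + 1)).t_smul_mem hz
    obtain ⟨w, hw, hwx⟩ := R.F_exact_succ i d k (x - t n • z) (sub_mem hx htz) hzx
    refine ⟨_, (R.L (i + 2)).cls_mem hw, ?_⟩
    refine ((R.L (i + 1)).cls_eq_iff (R.ψ_bifiltered (i + 1) d k w hw) hx).2 ?_
    rw [hwx]
    exact ⟨-z, neg_mem ⟨d, hz⟩, by rw [map_neg, sub_sub_cancel_left]; rfl⟩
  exact {
    exhaustive := hexh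
    free := fun i => isFilteredFree_free_filVQ k
    δ_filtered := fun i => mapVQ_isFiltered (R.ψ_bifiltered i) k
    η_filtered := augVQ_isFiltered R.ε_bifiltered k
    surjective := fun x => by
      obtain ⟨d, hx⟩ := hexh x
      obtain ⟨y, -, hy⟩ := hsurj d x hx
      exact ⟨y, hy⟩
    exact_zero := fun x => by
      constructor
      · intro h
        obtain ⟨d, hx⟩ := (R.L 0).exists_mem_filVQ x
        obtain ⟨y, -, hy⟩ := hzero d x hx h
        exact ⟨y, hy⟩
      · rintro ⟨y, rfl⟩
        obtain ⟨y, rfl⟩ := Submodule.Quotient.mk_surjective _ y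
        refine (Submodule.Quotient.mk_eq_zero _).2 ?_
        change R.ε (R.ψ 0 y) ∈ _
        rw [R.exact_zero.apply_apply_eq_zero]
        exact zero_mem _
    exact_succ := fun i x => by
      constructor
      · intro h
        obtain ⟨d, hx⟩ := (R.L (i + 1)).exists_mem_filVQ x
        obtain ⟨y, -, hy⟩ := hsucc i d x hx h
        exact ⟨y, hy⟩
      · rintro ⟨y, rfl⟩
        obtain ⟨y, rfl⟩ := Submodule.Quotient.mk_surjective _ y
        refine (Submodule.Quotient.mk_eq_zero _).2 ?_
        change R.ψ i (R.ψ (i + 1) y) ∈ (R.L i).tV k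
        rw [(R.exact_succ i).apply_apply_eq_zero]
        exact zero_mem _
    F_surjective := hsurj
    F_exact_zero := hzero
    F_exact_succ := hsucc }

end BifilteredFreeResolution

/-! ### Homogenization -/

section ReesModule

variable {n : ℕ} {N N' N'' : Type*} [AddCommGroup N] [Module (Dx n) N] [AddCommGroup N']
  [Module (Dx n) N'] [AddCommGroup N''] [Module (Dx n) N'']

lemma Rees.coeff_mem (Φ : FFiltration n N) (d : ℤ) (x : Rees Φ) : Rees.coeff Φ d x ∈ Φ.F d :=
  Subtype.property _

lemma Rees.coeff_of (Φ : FFiltration n N) (d e : ℤ) (x : N) (hx : x ∈ Φ.F d) :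
    Rees.coeff Φ e (Rees.of Φ d x hx) = if d = e then x else 0 := by
  classical
  refine (DirectSum.coe_of_apply d e (⟨x, hx⟩ : Φ.F d)).trans ?_
  split_ifs <;> rfl

lemma Rees.exists_coeff_eq (Φ : FFiltration n N) (y : ℤ → N) (hy : ∀ d, y d ∈ Φ.F d)
    (s : Finset ℤ) (hs : ∀ d, d ∉ s → y d = 0) : ∃ z : Rees Φ, ∀ d, Rees.coeff Φ d z = y d := by
  classical
  let z : Π₀ d : ℤ, Φ.F d := DFinsupp.mk s fun d : (s : Set ℤ) => ⟨y d, hy d⟩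
  refine ⟨z, fun d => ?_⟩
  change (z d : N) = y d
  rw [DFinsupp.mk_apply]
  split_ifs with h
  · rfl
  · exact (hs d h).symm

lemma Rees.exists_support {Φ : FFiltration n N} (x : Rees Φ) :
    ∃ s : Finset ℤ, ∀ d, d ∉ s → Rees.coeff Φ d x = 0 := by
  classical
  let z : Π₀ d : ℤ, Φ.F d := x
  refine ⟨z.support, fun d hd => ?_⟩
  have h : z d = 0 := DFinsupp.notMem_support_iff.1 hd
  exact congrArg Subtype.val h

lemma Rees.mem_grade_iff {Φ : FFiltration n N} {d : ℤ} {x : Rees Φ} :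
    x ∈ Rees.grade Φ d ↔ ∃ (y : N) (hy : y ∈ Φ.F d), Rees.of Φ d y hy = x := by
  constructor
  · rintro ⟨⟨y, hy⟩, rfl⟩
    exact ⟨y, hy, rfl⟩
  · rintro ⟨y, hy, rfl⟩
    exact ⟨⟨y, hy⟩, rfl⟩

lemma Rees.mem_grade_iff_coeff {Φ : FFiltration n N} {d : ℤ} {x : Rees Φ} :
    x ∈ Rees.grade Φ d ↔ ∀ e, e ≠ d → Rees.coeff Φ e x = 0 := by
  rw [Rees.mem_grade_iff]
  constructor
  · rintro ⟨y, hy, rfl⟩ e he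
    rw [Rees.coeff_of, if_neg he.symm]
  · intro h
    refine ⟨_, Rees.coeff_mem Φ d x, Rees.ext fun e => ?_⟩
    rw [Rees.coeff_of]
    split_ifs with he
    · rw [he]
    · exact (h e (Ne.symm he)).symm

lemma Rees.addHom_ext {Φ : FFiltration n N} {A : Type*} [AddCommGroup A] {f g : Rees Φ →+ A}
    (h : ∀ d x (hx : x ∈ Φ.F d), f (Rees.of Φ d x hx) = g (Rees.of Φ d x hx)) : f = g :=
  DirectSum.addHom_ext fun d x => h d x x.2

lemma Rees.map_of {Φ : FFiltration n N} {Φ' : FFiltration n N'} {φ : N →ₗ[Dx n] N'}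
    (hφ : IsFiltered Φ Φ' φ) (d : ℤ) (x : N) (hx : x ∈ Φ.F d) :
    Rees.map hφ (Rees.of Φ d x hx) = Rees.of Φ' d (φ x) (hφ d x hx) :=
  Rees.ext fun e => by
    rw [Rees.coeff_map, Rees.coeff_of, Rees.coeff_of]
    split_ifs
    · rfl
    · exact map_zero φ

lemma Rees.exists_map_eq {Φ : FFiltration n N} {Φ' : FFiltration n N'} {φ : N →ₗ[Dx n] N'}
    (hφ : IsFiltered Φ Φ' φ) (x : Rees Φ')
    (h : ∀ d, ∃ y ∈ Φ.F d, φ y = Rees.coeff Φ' d x) : ∃ z, Rees.map hφ z = x := by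
  classical
  obtain ⟨s, hs⟩ := Rees.exists_support x
  choose y hy hyx using h
  -- The chosen lifts of `0` need not be `0`; cutting off outside the support of `x` keeps the sum
  -- finite.
  obtain ⟨z, hz⟩ := Rees.exists_coeff_eq Φ (fun d => if d ∈ s then y d else 0)
    (fun d => by
      split_ifs
      · exact hy d
      · exact zero_mem _) s (fun d hd => if_neg hd)
  refine ⟨z, Rees.ext fun d => ?_⟩
  rw [Rees.coeff_map, hz]
  split_ifs with hd
  · exact hyx d
  · rw [map_zero, hs d hd]

lemma Rees.map_surjective {Φ : FFiltration n N} {Φ' : FFiltration n N'} {φ : N →ₗ[Dx n] N'}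
    (hφ : IsFiltered Φ Φ' φ) (h : ∀ d, ∀ x ∈ Φ'.F d, ∃ y ∈ Φ.F d, φ y = x) :
    Function.Surjective (Rees.map hφ) := fun x =>
  Rees.exists_map_eq hφ x fun d => h d _ (Rees.coeff_mem Φ' d x)

lemma Rees.map_exact {Φ : FFiltration n N} {Φ' : FFiltration n N'} {Φ'' : FFiltration n N''}
    {φ : N →ₗ[Dx n] N'} {ψ : N' →ₗ[Dx n] N''} (hφ : IsFiltered Φ Φ' φ)
    (hψ : IsFiltered Φ' Φ'' ψ) (hcomp : ∀ x, ψ (φ x) = 0)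
    (h : ∀ d, ∀ x ∈ Φ'.F d, ψ x = 0 → ∃ y ∈ Φ.F d, φ y = x) :
    Function.Exact (Rees.map hφ) (Rees.map hψ) := by
  intro x
  constructor
  · intro hx
    refine Rees.exists_map_eq hφ x fun d => h d _ (Rees.coeff_mem Φ' d x) ?_
    rw [← Rees.coeff_map hψ, hx, map_zero]
  · rintro ⟨z, rfl⟩
    refine Rees.ext fun d => ?_
    rw [Rees.coeff_map, Rees.coeff_map, hcomp, map_zero]

/-- The coefficient of `T^d` of an element of `𝐑𝒟`. -/
def RD.coeff (n : ℕ) (d : ℤ) : RD n →+ Dx n :=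
  (FDx n d).subtype.toAddMonoidHom.comp (DFinsupp.evalAddMonoidHom d)

lemma RD.coeff_mem (d : ℤ) (a : RD n) : RD.coeff n d a ∈ FDx n d := Subtype.property _

lemma RD.ext {a b : RD n} (h : ∀ d, RD.coeff n d a = RD.coeff n d b) : a = b :=
  DFinsupp.ext fun d => Subtype.ext (h d)

/-- The homogeneous element `P T^d` of `𝐑𝒟`, for `P ∈ F_d(𝒟)`. -/
def RD.of (d : ℤ) (P : Dx n) (hP : P ∈ FDx n d) : RD n :=
  DirectSum.of (fun d => FDx n d) d ⟨P, hP⟩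

lemma RD.coeff_of (d e : ℤ) (P : Dx n) (hP : P ∈ FDx n d) :
    RD.coeff n e (RD.of d P hP) = if d = e then P else 0 := by
  classical
  refine (DirectSum.coe_of_apply d e (⟨P, hP⟩ : FDx n d)).trans ?_
  split_ifs <;> rfl

lemma RD.mem_grade_iff_coeff {d : ℤ} {a : RD n} :
    a ∈ RD.grade n d ↔ ∀ e, e ≠ d → RD.coeff n e a = 0 := by
  constructor
  · rintro ⟨⟨y, hy⟩, rfl⟩ e he
    exact (RD.coeff_of d e y hy).trans (if_neg he.symm)
  · intro h
    refine ⟨⟨_, RD.coeff_mem d a⟩, RD.ext fun e => ?_⟩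
    refine (RD.coeff_of d e _ (RD.coeff_mem d a)).trans ?_
    split_ifs with he
    · rw [he]
    · exact (h e (Ne.symm he)).symm

lemma RD.of_smul_of (Φ : FFiltration n N) {d e : ℤ} {P : Dx n} (hP : P ∈ FDx n d) {x : N}
    (hx : x ∈ Φ.F e) :
    RD.of d P hP • Rees.of Φ e x hx = Rees.of Φ (d + e) (P • x) (Φ.smul_mem hP hx) :=
  DirectSum.Gmodule.of_smul_of (fun d => FDx n d) (fun d => Φ.F d) (i := d) (j := e)
    ⟨P, hP⟩ ⟨x, hx⟩

lemma Rees.coeff_smul_of (Φ : FFiltration n N) (a : RD n) (e : ℤ) {x : N} (hx : x ∈ Φ.F e)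
    (d : ℤ) : Rees.coeff Φ d (a • Rees.of Φ e x hx) = RD.coeff n (d - e) a • x := by
  revert a
  suffices h : ((Rees.coeff Φ d).comp ((AddMonoidHom.flip (smulAddHom (RD n) (Rees Φ)))
      (Rees.of Φ e x hx)) : RD n →+ N) =
      ((AddMonoidHom.flip (smulAddHom (Dx n) N)) x).comp (RD.coeff n (d - e)) from
    fun a => DFunLike.congr_fun h a
  refine DirectSum.addHom_ext fun c P => ?_
  change Rees.coeff Φ d (RD.of c P.1 P.2 • Rees.of Φ e x hx) =
    RD.coeff n (d - e) (RD.of c P.1 P.2) • x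
  rw [RD.of_smul_of, Rees.coeff_of, RD.coeff_of]
  by_cases h : c + e = d
  · rw [if_pos h, if_pos (by omega)]
  · rw [if_neg h, if_neg (by omega), zero_smul]

/-- A filtered basis `e_i` of degrees `s_i` yields the graded basis `e_i T^{s_i}`: the coefficient
of `T^d` in `∑ v_i e_i T^{s_i}` has as coordinates the coefficients of `T^{d - s_i}` in the `v_i`.
-/
lemma IsFilteredFree.isGradedFree {Φ : FFiltration n N} (h : IsFilteredFree Φ) :
    IsGradedFree (n := n) (Rees.grade Φ) := by
  obtain ⟨r, s, e, he⟩ := h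
  have hmem : ∀ i, e (Pi.single i 1) ∈ Φ.F (s i) := fun i => by
    rw [he]
    intro j
    by_cases hij : j = i
    · subst hij
      rw [Pi.single_eq_same, sub_self]
      exact one_mem_FD n
    · rw [Pi.single_eq_of_ne hij]
      exact Submodule.zero_mem _
  let E : (Fin r → RD n) →ₗ[RD n] Rees Φ :=
    Fintype.linearCombination (RD n) fun i => Rees.of Φ (s i) (e (Pi.single i 1)) (hmem i)
  have hcoeff : ∀ v d, Rees.coeff Φ d (E v) = e fun i => RD.coeff n (d - s i) (v i) := by
    intro v d
    rw [Fintype.linearCombination_apply, map_sum]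
    simp only [Rees.coeff_smul_of, ← map_smul]
    rw [← map_sum]
    congr 1
    ext i : 1
    rw [Finset.sum_apply, Finset.sum_eq_single i]
    · rw [Pi.smul_apply, Pi.single_eq_same, smul_eq_mul, mul_one]
    · intro j _ hj
      rw [Pi.smul_apply, Pi.single_eq_of_ne hj.symm, smul_zero]
    · exact fun h => absurd (Finset.mem_univ _) h
  have hzero : ∀ v d, Rees.coeff Φ d (E v) = 0 ↔ ∀ i, RD.coeff n (d - s i) (v i) = 0 := by
    intro v d
    rw [hcoeff, LinearEquiv.map_eq_zero_iff, funext_iff]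
    rfl
  have hinj : Function.Injective E := by
    rw [← LinearMap.ker_eq_bot, LinearMap.ker_eq_bot']
    intro v hv
    ext i : 1
    refine RD.ext fun d => ?_
    have h := (hzero v (d + s i)).1 (by rw [hv, map_zero]) i
    rw [add_sub_cancel_right] at h
    rw [h, Pi.zero_apply, map_zero]
  have hsurj : Function.Surjective E := by
    intro x
    suffices h : ∀ (d : ℤ) (y : Φ.F d), Rees.of Φ d y y.2 ∈ LinearMap.range E by
      change x ∈ LinearMap.range E
      have hx : (x : ⨁ d : ℤ, Φ.F d) ∈ (LinearMap.range E).toAddSubmonoid := by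
        generalize (LinearMap.range E) = S at h
        induction x using DirectSum.induction_on with
        | zero => exact S.zero_mem
        | of d y => exact h d y
        | add x y hx hy => exact S.add_mem hx hy
      exact hx
    rintro d ⟨y, hy⟩
    obtain ⟨w, rfl⟩ := e.surjective y
    refine ⟨fun i => RD.of (d - s i) (w i) ((he d w).1 hy i), Rees.ext fun d' => ?_⟩
    rw [hcoeff, Rees.coeff_of]
    simp only [RD.coeff_of, sub_left_inj]
    split_ifs
    · rfl
    · exact map_zero e
  refine ⟨r, s, LinearEquiv.ofBijective E ⟨hinj, hsurj⟩, fun d v => ?_⟩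
  change E v ∈ _ ↔ _
  rw [Rees.mem_grade_iff_coeff]
  simp only [RD.mem_grade_iff_coeff, hzero]
  constructor
  · intro h i c hc
    have := h (c + s i) (by omega) i
    rwa [add_sub_cancel_right] at this
  · exact fun h c hc i => h i (c - s i) (by omega)

lemma IsGradedFree.of_equiv {Q Q' : Type*} [AddCommGroup Q] [Module (RD n) Q] [AddCommGroup Q']
    [Module (RD n) Q'] {G : ℤ → AddSubgroup Q} {G' : ℤ → AddSubgroup Q'}
    (h : IsGradedFree (n := n) G) (Θ : Q ≃ₗ[RD n] Q') (hΘ : ∀ d x, Θ x ∈ G' d ↔ x ∈ G d) :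
    IsGradedFree (n := n) G' := by
  obtain ⟨r, s, e, he⟩ := h
  exact ⟨r, s, e.trans Θ, fun d v => (hΘ d (e v)).trans (he d v)⟩

end ReesModule

/-! ### The homogenization of `V_k(M) / t V_{k+1}(M)` -/

namespace Bifiltration

variable {n : ℕ} {M : Type*} [AddCommGroup M] [Module (Dxt n) M] (B : Bifiltration n M)

/-- The filtration of `V_k(M)` by the `F_{d,k}(M)`. -/
def levelV (k : ℤ) : FFiltration n (B.V k) where
  F d := (B.F d k).comap (B.V k).subtype.toAddMonoidHom
  mono d := AddSubgroup.comap_mono (B.mono_left d k)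
  smul_mem hP hx := B.Dx_smul_mem hP hx

lemma subtype_isFiltered (k : ℤ) : IsFiltered (B.levelV k) (B.level k) (B.V k).subtype :=
  fun _ _ hx => hx

lemma mkQ_isFiltered_filVQ (k : ℤ) : IsFiltered (B.levelV k) (B.filVQ k)
    ((B.tV k).submoduleOf (B.V k)).mkQ :=
  fun _ x hx => ⟨x, hx, rfl⟩

/-- The surjection from the homogenization of `V_k(M)` to `V_k(𝐑M) / t V_{k+1}(𝐑M)`. -/
def toVRQ (k : ℤ) : Rees (B.levelV k) →ₗ[RD n] B.VRQ k :=
  (LinearMap.range (B.tR k)).mkQ ∘ₗ Rees.map (B.subtype_isFiltered k)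

/-- The surjection from the homogenization of `V_k(M)` to that of `V_k(M) / t V_{k+1}(M)`. -/
def toReesVQ (k : ℤ) : Rees (B.levelV k) →ₗ[RD n] Rees (B.filVQ k) :=
  Rees.map (B.mkQ_isFiltered_filVQ k)

lemma toVRQ_surjective (k : ℤ) : Function.Surjective (B.toVRQ k) :=
  (Submodule.mkQ_surjective _).comp (Rees.map_surjective _ fun d x hx => ⟨⟨x, d, hx⟩, hx, rfl⟩)

lemma toReesVQ_surjective (k : ℤ) : Function.Surjective (B.toReesVQ k) :=
  Rees.map_surjective _ (by rintro d _ ⟨x, hx, rfl⟩; exact ⟨x, hx, rfl⟩)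

/-- One kernel asks that each coefficient lie in `tV_{k+1}`, the other that it lie in `tF_{d,k+1}`.
For elements of `F_{d,k}` the hypothesis makes these the same. -/
lemma ker_toReesVQ_eq {k : ℤ} (hF : ∀ d, B.F d k ⊓ (B.tV k).toAddSubgroup =
    (B.F d (k + 1)).map (tmul n M).toAddMonoidHom) :
    LinearMap.ker (B.toReesVQ k) = LinearMap.ker (B.toVRQ k) := by
  ext x
  have h1 : x ∈ LinearMap.ker (B.toReesVQ k) ↔
      ∀ d, ((Rees.coeff (B.levelV k) d x : B.V k) : M) ∈ B.tV k := by
    rw [LinearMap.mem_ker]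
    constructor
    · intro h d
      have h2 := congrArg (Rees.coeff (B.filVQ k) d) h
      rw [toReesVQ, Rees.coeff_map, map_zero] at h2
      exact (Submodule.Quotient.mk_eq_zero ((B.tV k).submoduleOf (B.V k))).1 h2
    · intro h
      refine Rees.ext fun d => ?_
      rw [toReesVQ, Rees.coeff_map, map_zero]
      exact (Submodule.Quotient.mk_eq_zero _).2 (h d)
  rw [h1, LinearMap.mem_ker, toVRQ, LinearMap.comp_apply, Submodule.mkQ_apply,
    Submodule.Quotient.mk_eq_zero]
  constructor
  · intro h
    refine Rees.exists_map_eq (Φ := B.level (k + 1)) (Φ' := B.level k) (φ := tmul n M) _ _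
      fun d => ?_
    have h2 : ((Rees.coeff (B.levelV k) d x : B.V k) : M) ∈
        B.F d k ⊓ (B.tV k).toAddSubgroup := ⟨Rees.coeff_mem (B.levelV k) d x, h d⟩
    rw [hF] at h2
    exact h2
  · rintro ⟨y, hy⟩ d
    have h2 := congrArg (Rees.coeff (B.level k) d) hy
    rw [Rees.coeff_map] at h2
    exact ⟨Rees.coeff (B.level (k + 1)) d y,
      ⟨d, Rees.coeff_mem (B.level (k + 1)) d y⟩, h2⟩

/-- The isomorphism `𝐑(V_k(M) / t V_{k+1}(M)) ≃ V_k(𝐑M) / t V_{k+1}(𝐑M)`. -/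
def reesEquiv {k : ℤ} (hF : ∀ d, B.F d k ⊓ (B.tV k).toAddSubgroup =
    (B.F d (k + 1)).map (tmul n M).toAddMonoidHom) : Rees (B.filVQ k) ≃ₗ[RD n] B.VRQ k :=
  ((B.toReesVQ k).quotKerEquivOfSurjective (B.toReesVQ_surjective k)).symm ≪≫ₗ
    Submodule.quotEquivOfEq _ _ (B.ker_toReesVQ_eq hF) ≪≫ₗ
      (B.toVRQ k).quotKerEquivOfSurjective (B.toVRQ_surjective k)

variable {k : ℤ} (hF : ∀ d, B.F d k ⊓ (B.tV k).toAddSubgroup =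
    (B.F d (k + 1)).map (tmul n M).toAddMonoidHom)

lemma reesEquiv_toReesVQ (x : Rees (B.levelV k)) :
    B.reesEquiv hF (B.toReesVQ k x) = B.toVRQ k x := by
  have h : ((B.toReesVQ k).quotKerEquivOfSurjective (B.toReesVQ_surjective k)).symm
      (B.toReesVQ k x) = Submodule.Quotient.mk x := by
    rw [LinearEquiv.symm_apply_eq]
    rfl
  rw [reesEquiv, LinearEquiv.trans_apply, LinearEquiv.trans_apply, h]
  rfl

lemma reesEquiv_of_cls {d : ℤ} {x : M} (hx : x ∈ B.F d k) :
    B.reesEquiv hF (Rees.of (B.filVQ k) d (B.cls hx) (B.cls_mem hx)) =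
      Submodule.Quotient.mk (Rees.of (B.level k) d x hx) := by
  have h := B.reesEquiv_toReesVQ hF (Rees.of (B.levelV k) d ⟨x, d, hx⟩ hx)
  have h1 := Rees.map_of (B.mkQ_isFiltered_filVQ k) d ⟨x, d, hx⟩ hx
  have h2 := Rees.map_of (B.subtype_isFiltered k) d ⟨x, d, hx⟩ hx
  exact (congrArg (B.reesEquiv hF) h1).symm.trans
    (h.trans (congrArg Submodule.Quotient.mk h2))

lemma reesEquiv_mem_gradeVRQ_iff {d : ℤ} {z : Rees (B.filVQ k)} :
    B.reesEquiv hF z ∈ B.gradeVRQ k d ↔ z ∈ Rees.grade (B.filVQ k) d := by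
  constructor
  · rintro ⟨y, hy, hyz⟩
    obtain ⟨x, hx, rfl⟩ := Rees.mem_grade_iff.1 hy
    have h := (B.reesEquiv hF).injective ((B.reesEquiv_of_cls hF hx).trans hyz)
    exact Rees.mem_grade_iff.2 ⟨_, _, h⟩
  · intro hz
    obtain ⟨y, hy, rfl⟩ := Rees.mem_grade_iff.1 hz
    obtain ⟨x, hx, rfl⟩ := B.mem_filVQ_iff.1 hy
    rw [reesEquiv_of_cls]
    exact ⟨_, Rees.mem_grade_iff.2 ⟨x, hx, rfl⟩, rfl⟩

/-- The elements `[x]T^d` generate additively, so the squares with the differentials need only be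
checked on them. -/
lemma rees_filVQ_hom_ext {A : Type*} [AddCommGroup A] {f g : Rees (B.filVQ k) →+ A}
    (h : ∀ d x (hx : x ∈ B.F d k), f (Rees.of (B.filVQ k) d (B.cls hx) (B.cls_mem hx)) =
      g (Rees.of (B.filVQ k) d (B.cls hx) (B.cls_mem hx))) : f = g :=
  Rees.addHom_ext fun d z hz => by
    obtain ⟨x, hx, rfl⟩ := B.mem_filVQ_iff.1 hz
    exact h d x hx

end Bifiltration

/-! ### Compatibility of homogenization with the induced maps -/

section InducedReesEquiv

variable {n : ℕ} {M M' : Type*} [AddCommGroup M] [Module (Dxt n) M] [AddCommGroup M']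
  [Module (Dxt n) M'] {B : Bifiltration n M} {B' : Bifiltration n M'} {φ : M →ₗ[Dxt n] M'}
  {k : ℤ} (hφ : IsBifiltered B B' φ)
  (hF : ∀ d, B.F d k ⊓ (B.tV k).toAddSubgroup =
    (B.F d (k + 1)).map (tmul n M).toAddMonoidHom)

lemma mapVRQ_mk_of {d : ℤ} {x : M} (hx : x ∈ B.F d k) :
    mapVRQ hφ k (Submodule.Quotient.mk (Rees.of (B.level k) d x hx)) =
      Submodule.Quotient.mk (Rees.of (B'.level k) d (φ x) (hφ d k x hx)) :=
  congrArg Submodule.Quotient.mk (Rees.map_of (Φ := B.level k) (Φ' := B'.level k)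
    (φ := φ.restrictScalars (Dx n)) (fun d x hx => hφ d k x hx) d x hx)

lemma augVRQ_mk_of {d : ℤ} {x : M} (hx : x ∈ B.F d k) :
    augVRQ hφ k (Submodule.Quotient.mk (Rees.of (B.level k) d x hx)) =
      Rees.of (B'.filMt k) d (Submodule.Quotient.mk (φ x)) ⟨φ x, hφ d k x hx, rfl⟩ := by
  have h1 := Rees.map_of (Φ := B.level k) (Φ' := B'.level k)
    (φ := φ.restrictScalars (Dx n)) (fun d x hx => hφ d k x hx) d x hx
  have h2 := Rees.map_of (mkQ_isFiltered B' k) d (φ x) (hφ d k x hx)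
  exact (congrArg (Rees.map (mkQ_isFiltered B' k)) h1).trans h2

lemma reesEquiv_map_mapVQ (hF' : ∀ d, B'.F d k ⊓ (B'.tV k).toAddSubgroup =
    (B'.F d (k + 1)).map (tmul n M').toAddMonoidHom) (z : Rees (B.filVQ k)) :
    B'.reesEquiv hF' (Rees.map (mapVQ_isFiltered hφ k) z) =
      mapVRQ hφ k (B.reesEquiv hF z) := by
  refine DFunLike.congr_fun (B.rees_filVQ_hom_ext
    (f := (((B'.reesEquiv hF').toLinearMap ∘ₗ Rees.map (mapVQ_isFiltered hφ k) :
      Rees (B.filVQ k) →ₗ[RD n] B'.VRQ k) : Rees (B.filVQ k) →+ B'.VRQ k))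
    (g := ((mapVRQ hφ k ∘ₗ (B.reesEquiv hF).toLinearMap :
      Rees (B.filVQ k) →ₗ[RD n] B'.VRQ k) : Rees (B.filVQ k) →+ B'.VRQ k))
    fun d x hx => ?_) z
  change B'.reesEquiv hF' (Rees.map (mapVQ_isFiltered hφ k) (Rees.of _ d (B.cls hx) _)) =
    mapVRQ hφ k (B.reesEquiv hF (Rees.of _ d (B.cls hx) _))
  rw [B.reesEquiv_of_cls, mapVRQ_mk_of, Rees.map_of, ← B'.reesEquiv_of_cls hF']
  rfl

lemma map_augVQ_eq (z : Rees (B.filVQ k)) :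
    Rees.map (augVQ_isFiltered hφ k) z = augVRQ hφ k (B.reesEquiv hF z) := by
  refine DFunLike.congr_fun (B.rees_filVQ_hom_ext
    (f := (Rees.map (augVQ_isFiltered hφ k) : Rees (B.filVQ k) →+ Rees (B'.filMt k)))
    (g := ((augVRQ hφ k ∘ₗ (B.reesEquiv hF).toLinearMap :
      Rees (B.filVQ k) →ₗ[RD n] Rees (B'.filMt k)) : Rees (B.filVQ k) →+ Rees (B'.filMt k)))
    fun d x hx => ?_) z
  change Rees.map (augVQ_isFiltered hφ k) (Rees.of _ d (B.cls hx) _) =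
    augVRQ hφ k (B.reesEquiv hF (Rees.of _ d (B.cls hx) _))
  rw [B.reesEquiv_of_cls, augVRQ_mk_of, Rees.map_of]
  rfl

end InducedReesEquiv

/-! ### The graded free resolution -/

namespace BifilteredFreeResolution

variable {n : ℕ} {M : Type*} [AddCommGroup M] [Module (Dxt n) M] {B : Bifiltration n M}
  (R : BifilteredFreeResolution B)

/-- The isomorphism `𝐑(V_k(L_i) / t V_{k+1}(L_i)) ≃ V_k(𝐑L_i) / t V_{k+1}(𝐑L_i)`. -/
def reesEquiv (k : ℤ) (i : ℕ) : Rees ((R.L i).filVQ k) ≃ₗ[RD n] (R.L i).VRQ k :=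
  (R.L i).reesEquiv fun d => free_F_inf_tV d k

/-- The homogenized complex is exact because the filtered one is exact in each degree; freeness and
exactness are carried across the isomorphisms, which commute with the maps and preserve degrees. -/
lemma isGradedFreeResolution {k : ℤ}
    (h : IsFilteredFreeResolution (fun i => (R.L i).filVQ k) (B.filMt k)
      (fun i => mapVQ (R.ψ_bifiltered i) k) (augVQ R.ε_bifiltered k)) :
    IsGradedFreeResolution n (fun i => (R.L i).gradeVRQ k) (Rees.grade (B.filMt k))
      (fun i => mapVRQ (R.ψ_bifiltered i) k) (augVRQ R.ε_bifiltered k) where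
  free i := (h.free i).isGradedFree.of_equiv (R.reesEquiv k i)
    fun _ _ => (R.L i).reesEquiv_mem_gradeVRQ_iff _
  δ_graded i d := by
    rintro _ ⟨y, hy, rfl⟩
    obtain ⟨x, hx, rfl⟩ := Rees.mem_grade_iff.1 hy
    exact ⟨_, Rees.mem_grade_iff.2 ⟨_, _, rfl⟩, (mapVRQ_mk_of (R.ψ_bifiltered i) hx).symm⟩
  η_graded d := by
    rintro _ ⟨y, hy, rfl⟩
    obtain ⟨x, hx, rfl⟩ := Rees.mem_grade_iff.1 hy
    exact Rees.mem_grade_iff.2 ⟨_, _, (augVRQ_mk_of R.ε_bifiltered hx).symm⟩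
  surjective x := by
    obtain ⟨z, rfl⟩ := Rees.map_surjective (augVQ_isFiltered R.ε_bifiltered k) h.F_surjective x
    exact ⟨_, (map_augVQ_eq R.ε_bifiltered (fun d => free_F_inf_tV d k) z).symm⟩
  exact_zero x := by
    obtain ⟨z, rfl⟩ := (R.reesEquiv k 0).surjective x
    have hex := Rees.map_exact (mapVQ_isFiltered (R.ψ_bifiltered 0) k)
      (augVQ_isFiltered R.ε_bifiltered k) h.exact_zero.apply_apply_eq_zero h.F_exact_zero z
    -- Precomposing with a surjection does not change the range, so both ranges are now indexed by
    -- elements of the homogenized module.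
    rw [reesEquiv, ← map_augVQ_eq, hex, ← (R.reesEquiv k 1).surjective.range_comp]
    constructor
    · rintro ⟨w, rfl⟩
      exact ⟨w, (reesEquiv_map_mapVQ (R.ψ_bifiltered 0) _ _ w).symm⟩
    · rintro ⟨w, hw⟩
      exact ⟨w, ((R.L 0).reesEquiv fun d => free_F_inf_tV d k).injective
        ((reesEquiv_map_mapVQ (R.ψ_bifiltered 0) _ _ w).trans hw)⟩
  exact_succ i x := by
    obtain ⟨z, rfl⟩ := (R.reesEquiv k (i + 1)).surjective x
    have hex := Rees.map_exact (mapVQ_isFiltered (R.ψ_bifiltered (i + 1)) k)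
      (mapVQ_isFiltered (R.ψ_bifiltered i) k) (h.exact_succ i).apply_apply_eq_zero
      (h.F_exact_succ i) z
    rw [reesEquiv, ← reesEquiv_map_mapVQ _ _ (fun d => free_F_inf_tV d k),
      LinearEquiv.map_eq_zero_iff, hex, ← (R.reesEquiv k (i + 2)).surjective.range_comp]
    constructor
    · rintro ⟨w, rfl⟩
      exact ⟨w, (reesEquiv_map_mapVQ (R.ψ_bifiltered (i + 1)) _ _ w).symm⟩
    · rintro ⟨w, hw⟩
      exact ⟨w, ((R.L (i + 1)).reesEquiv fun d => free_F_inf_tV d k).injective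
        ((reesEquiv_map_mapVQ (R.ψ_bifiltered (i + 1)) _ _ w).trans hw)⟩

end BifilteredFreeResolution

end FilteredRestriction

end

open FilteredRestriction in
theorem mainTheorem2 (n : ℕ) {M : Type*} [AddCommGroup M] [Module (Dxt n) M]
    -- a good bifiltration of `M` with `M = 𝒟_{x,t} V_0(M)`
    (B : Bifiltration n M) (hgood : B.IsGood)
    (hgen : Submodule.span (Dxt n) (B.V 0 : Set M) = ⊤)
    -- `b ≠ 0` and `b(t ∂_t) gr^V_0(M) = 0`
    (b : Polynomial ℂ) (hb : b ≠ 0)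
    (hb_zero : ∀ x ∈ B.V 0, Polynomial.aeval (t n * dt n) b • x ∈ B.V (-1))
    -- `b(k) ≠ 0` for all integers `k > k₁`
    (k₁ : ℤ) (hk₁ : ∀ k : ℤ, k₁ < k → b.eval (k : ℂ) ≠ 0)
    -- `b(t ∂_t + k) gr^V_k(M) = 0` for `k₁ < k < 0` (a void condition if `k₁ ≥ -1`)
    (hb_neg : ∀ k : ℤ, k₁ < k → k < 0 →
      ∀ x ∈ B.V k, Polynomial.aeval (t n * dt n + (k : Dxt n)) b • x ∈ B.V (k - 1))
    -- a bifiltered free resolution of `M`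
    (R : BifilteredFreeResolution B)
    -- `t` is injective on `M`, and `F_{d,k₁}(M) ∩ t V_{k₁+1}(M) = t F_{d,k₁+1}(M)` for all `d`
    (ht : Function.Injective fun x : M => t n • x)
    (hF : ∀ d : ℤ, B.F d k₁ ⊓ (B.tV k₁).toAddSubgroup =
      (B.F d (k₁ + 1)).map (tmul n M).toAddMonoidHom) :
    -- `F_{d,k₁}(L_i) ∩ t V_{k₁+1}(L_i) = t F_{d,k₁+1}(L_i)`
    (∀ (i : ℕ) (d : ℤ), (R.L i).F d k₁ ⊓ ((R.L i).tV k₁).toAddSubgroup =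
      ((R.L i).F d (k₁ + 1)).map (tmul n (Fin (R.r i) → Dxt n)).toAddMonoidHom) ∧
    -- `V_{k₁}(L_•) / t V_{k₁+1}(L_•) → M / tM` is an `F`-filtered free resolution
    IsFilteredFreeResolution (fun i => (R.L i).filVQ k₁) (B.filMt k₁)
      (fun i => mapVQ (R.ψ_bifiltered i) k₁) (augVQ R.ε_bifiltered k₁) ∧
    -- its homogenization is `V_{k₁}(𝐑L_•) / t V_{k₁+1}(𝐑L_•) → 𝐑(M / tM)`
    (∃ Θ : ∀ i : ℕ, Rees ((R.L i).filVQ k₁) ≃ₗ[RD n] (R.L i).VRQ k₁,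
      (∀ (i : ℕ) (d : ℤ) (x : Fin (R.r i) → Dxt n) (hx : x ∈ (R.L i).F d k₁),
        Θ i (Rees.of ((R.L i).filVQ k₁) d ((R.L i).cls hx) ((R.L i).cls_mem hx)) =
          Submodule.Quotient.mk (Rees.of ((R.L i).level k₁) d x hx)) ∧
      (∀ (i : ℕ) (z : Rees ((R.L (i + 1)).filVQ k₁)),
        Θ i (Rees.map (mapVQ_isFiltered (R.ψ_bifiltered i) k₁) z) =
          mapVRQ (R.ψ_bifiltered i) k₁ (Θ (i + 1) z)) ∧
      (∀ z : Rees ((R.L 0).filVQ k₁),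
        Rees.map (augVQ_isFiltered R.ε_bifiltered k₁) z = augVRQ R.ε_bifiltered k₁ (Θ 0 z))) ∧
    -- and this is a graded free resolution of `𝐑(M / tM)`
    IsGradedFreeResolution n (fun i => (R.L i).gradeVRQ k₁) (Rees.grade (B.filMt k₁))
      (fun i => mapVRQ (R.ψ_bifiltered i) k₁) (augVRQ R.ε_bifiltered k₁) := by
  have hfil := R.isFilteredFreeResolution
    (B.exists_mem_V_eq_add_t_smul hgen hb_zero hk₁ hb_neg)
    (fun _ => B.exists_mem_V_of_t_smul_mem hgen hb_zero hk₁ hb_neg) ht hF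
  exact ⟨fun i d => free_F_inf_tV d k₁, hfil,
    ⟨R.reesEquiv k₁, fun i _ _ hx => (R.L i).reesEquiv_of_cls _ hx,
      fun i z => reesEquiv_map_mapVQ (R.ψ_bifiltered i) _ _ z,
      fun z => map_augVQ_eq R.ε_bifiltered _ z⟩,
    R.isGradedFreeResolution hfil⟩
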